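/- Let $G$ be a local Lie group with Lie algebra $\mathfrak g$ (real, finite-dimensional), written in normal coordinates, i.e. identified near $e$ with a neighbourhood of $0$ in $\mathfrak g$ by $\exp$. Let $H=\exp\mathfrak h$ be a local closed subgroup with Lie algebra $\mathfrak h$, let $\mathfrak g=V\oplus\mathfrak h$ as vector spaces, and let $\Pi:\mathfrak g\to V$ be the projection parallel to $\mathfrak h$. Let $Q=\{\exp(\xi+\varphi(\xi)):\xi\in V \text{ near } 0\}$ be a smooth section of the left cosets of $H$ with $T_eQ=V$, where $\varphi:V\to\mathfrak h$ is smooth near $0$, $\varphi(0)=0$, $d\varphi(0)=0$, and let $R:V\times V\to\mathfrak h$ be the symmetric bilinear map with $\varphi(\xi)=R(\xi,\xi)+o(\|\xi\|^2)$. On $Q$, with coordinate $\xi\in V$, consider the local loop $x\times y=\Pi_Q(x\cdot y)$, where $\Pi_Q:G\to Q$ is the projection parallel to $H$, so that $g\in\Pi_Q(g)H$. Write $\mu(x,y)$ for the loop product in coordinates. The associated 3-web, near $(e,e)$ in $Q\times Q$, has the leaves $x=\mathrm{const}$, $y=\mathrm{const}$, $x\times y=\mathrm{const}$. Put $P=\partial\mu/\partial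 x$, $\widehat Q=\partial\mu/\partial y$, $\omega_1=P\,dx$, $\omega_2=\widehat Q\,dy$, and $$\Gamma^k_{ij}=-(P^{-1})^\alpha_i(\widehat Q^{-1})^\beta_j\frac{\partial^2\mu^k}{\partial x^\alpha\partial y^\beta},\qquad \omega^k_j=\Gamma^k_{ij}\omega_1^i+\Gamma^k_{jl}\omega_2^l$$ (the Chern connection; the covariant derivative of a vector is $d\xi^k+\omega^k_j\xi^j$). The tensor $b$ is defined by $d\omega^k_j-\omega^i_j\wedge\omega^k_i=b^k_{jlm}\,\omega_1^l\wedge\omega_2^m$, and $d^i_{jklm}=\overset{2}{\nabla}_m b^i_{jkl}$ is its covariant derivative along $\omega_1=0$, i.e. the coefficient of $\omega_2^m$. Round brackets denote symmetrization. The web is called hexagonal if $b^i_{(jkl)}=0$ at all points near $(e,e)$. Let $\underset{\xi\eta\zeta}{\sigma}$ denote the cyclic sum over $\xi,\eta,\zeta$. Then: 1. $b^i_{(jkl)}=0$ at $(e,e)$ if and only if, for all $\xi,\eta,\zeta\in V$, $$\underset{\xi\eta\zeta}{\sigma}\,\Pi[R(\xi,\eta),\zeta]=0.$$ 2. If the web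 is hexagonal, then $b^i_{(jkl)}=0$ and $d^i_{(jkl)m}=0$ at $(e,e)$. 3. If $b^i_{(jkl)}=0$ and $d^i_{(jkl)m}=0$ at $(e,e)$ (in particular, if the web is hexagonal), then for all $\xi,\eta,\zeta,\tau\in V$ $$\underset{\xi\eta\zeta}{\sigma}\,\Pi\Big\{[\tau,[R(\xi,\eta),\zeta]]-\big[\Pi[\tau,R(\xi,\eta)],\zeta\big]\Big\}=0.$$ -/

import Mathlib

open Filter Topology
open scoped ContDiff

noncomputable section

/-! ### The three-web of a local loop and its Chern connection

A local loop is given in coordinates by a product `μ : F → F → F` near `(0, 0)`.  Its three-web lives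
on a neighbourhood of `(0, 0)` in `F × F` and has the leaves `x = const`, `y = const` and
`μ x y = const`. -/

namespace ThreeWeb

variable {F : Type*} [NormedAddCommGroup F] [NormedSpace ℝ F]

/-- The Jacobian `P = ∂μ/∂x`; the first web form is `ω₁ = P dx`. -/
def P (μ : F → F → F) (p : F × F) : F →L[ℝ] F :=
  fderiv ℝ (fun x => μ x p.2) p.1

/-- The Jacobian `Q = ∂μ/∂y`; the second web form is `ω₂ = Q dy`. -/
def Q (μ : F → F → F) (p : F × F) : F →L[ℝ] F :=
  fderiv ℝ (fun y => μ p.1 y) p.2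

/-- The mixed second derivative `∂²μ/∂x∂y`, with arguments in the order `x`, `y`. -/
def mixedDeriv (μ : F → F → F) (p : F × F) : F →L[ℝ] F →L[ℝ] F :=
  fderiv ℝ (fun x => fderiv ℝ (fun y => μ x y) p.2) p.1

/-- `Γ^k_{ij} = - P⁻¹^α_i Q⁻¹^β_j ∂²μ^k/∂x^α∂y^β`, contracted with `ξ^i η^j`. -/
def Gam (μ : F → F → F) (p : F × F) (ξ η : F) : F :=
  -mixedDeriv μ p ((P μ p).inverse ξ) ((Q μ p).inverse η)

/-- The connection form `ω^k_j = Γ^k_{ij} ω₁^i + Γ^k_{jl} ω₂^l` of the Chern connection, evaluated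
on the tangent vector `X` at `p` and contracted with `ξ^j`. -/
def conn (μ : F → F → F) (p X : F × F) (ξ : F) : F :=
  Gam μ p (P μ p X.1) ξ + Gam μ p ξ (Q μ p X.2)

/-- The tangent vector at `p` with `ω₁ = η`, `ω₂ = 0`. -/
def frame₁ (μ : F → F → F) (p : F × F) (η : F) : F × F := ((P μ p).inverse η, 0)

/-- The tangent vector at `p` with `ω₁ = 0`, `ω₂ = ζ`. -/
def frame₂ (μ : F → F → F) (p : F × F) (ζ : F) : F × F := (0, (Q μ p).inverse ζ)

/-- The curvature tensor `b^k_{jlm}` of the web at `p`, contracted with `ξ^j η^l ζ^m`.  It is defined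
by `dω^k_j - ω^i_j ∧ ω^k_i = b^k_{jlm} ω₁^l ∧ ω₂^m`, evaluated on the vectors `frame₁ η`, `frame₂ ζ`
(extended to constant, hence commuting, vector fields). -/
def b (μ : F → F → F) (p : F × F) (ξ η ζ : F) : F :=
  fderiv ℝ (fun q => conn μ q (frame₂ μ p ζ) ξ) p (frame₁ μ p η)
    - fderiv ℝ (fun q => conn μ q (frame₁ μ p η) ξ) p (frame₂ μ p ζ)
    - (conn μ p (frame₂ μ p ζ) (conn μ p (frame₁ μ p η) ξ)
      - conn μ p (frame₁ μ p η) (conn μ p (frame₂ μ p ζ) ξ))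

/-- The tensor `d^i_{jklm} = ∇²_m b^i_{jkl}` at `p`, contracted with `ξ^j η^k ζ^l τ^m`: the covariant
derivative of `b` for the Chern connection, in the direction of `frame₂ τ`. -/
def d (μ : F → F → F) (p : F × F) (ξ η ζ τ : F) : F :=
  fderiv ℝ (fun q => b μ q ξ η ζ) p (frame₂ μ p τ)
    + conn μ p (frame₂ μ p τ) (b μ p ξ η ζ)
    - b μ p (conn μ p (frame₂ μ p τ) ξ) η ζ
    - b μ p ξ (conn μ p (frame₂ μ p τ) η) ζ
    - b μ p ξ η (conn μ p (frame₂ μ p τ) ζ)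

/-- Symmetrization of a function of three arguments (round brackets around three indices). -/
def sym₃ (f : F → F → F → F) (ξ η ζ : F) : F :=
  (1 / 6 : ℝ) • (f ξ η ζ + f η ζ ξ + f ζ ξ η + f η ξ ζ + f ξ ζ η + f ζ η ξ)

/-- The condition `b^i_{(jkl)} = 0` at the point `p` of the web. -/
def SymBVanishesAt (μ : F → F → F) (p : F × F) : Prop :=
  ∀ ξ η ζ : F, sym₃ (b μ p) ξ η ζ = 0

/-- The condition `d^i_{(jkl)m} = 0` at the point `p` of the web. -/
def SymDVanishesAt (μ : F → F → F) (p : F × F) : Prop :=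
  ∀ ξ η ζ τ : F, sym₃ (fun ξ η ζ => d μ p ξ η ζ τ) ξ η ζ = 0

/-- The web of the local loop `μ` is hexagonal: `b^i_{(jkl)} = 0` at every point of the web. -/
def IsHexagonal (μ : F → F → F) : Prop :=
  ∀ᶠ p in 𝓝 ((0, 0) : F × F), SymBVanishesAt μ p

end ThreeWeb

/-! ### Local Lie groups and loops embedded as sections of `G / H` -/

/-- A local Lie group in normal coordinates: a neighbourhood of `0` in the vector space `E` underlying
the Lie algebra, the exponential map being the identity.  The inverse of `x` is `-x`. -/
structure LocalLieGroup (E : Type*) [NormedAddCommGroup E] [NormedSpace ℝ E] where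
  mul : E → E → E
  contDiffAt_mul : ContDiffAt ℝ ∞ (fun p : E × E => mul p.1 p.2) (0, 0)
  mul_zero : ∀ᶠ x in 𝓝 (0 : E), mul x 0 = x
  zero_mul : ∀ᶠ x in 𝓝 (0 : E), mul 0 x = x
  mul_assoc : ∀ᶠ p in 𝓝 ((0, 0, 0) : E × E × E),
    mul (mul p.1 p.2.1) p.2.2 = mul p.1 (mul p.2.1 p.2.2)
  /-- The coordinates are normal: `t ↦ t • x` are the one-parameter subgroups. -/
  mul_smul_smul : ∀ᶠ x in 𝓝 (0 : E), ∀ s ∈ Set.Icc (-1 : ℝ) 1, ∀ t ∈ Set.Icc (-1 : ℝ) 1,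
    mul (s • x) (t • x) = (s + t) • x

/-- The Lie bracket of a local Lie group: the antisymmetrized mixed second derivative of the
multiplication at the identity. -/
def LocalLieGroup.bracket {E : Type*} [NormedAddCommGroup E] [NormedSpace ℝ E]
    (G : LocalLieGroup E) (X Y : E) : E :=
  ThreeWeb.mixedDeriv G.mul (0, 0) X Y - ThreeWeb.mixedDeriv G.mul (0, 0) Y X

/-- A local loop embedded in a local Lie group `G` as a section `Q` of the left cosets of `H`, where
`H = exp 𝔥` is a local subgroup and `Q = {exp (ξ + φ ξ) | ξ ∈ V}` is a submanifold with tangent space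
`V` at the identity, `V` being a complement of `𝔥`. -/
structure EmbeddedLoop (E : Type*) [NormedAddCommGroup E] [NormedSpace ℝ E] where
  G : LocalLieGroup E
  V : Submodule ℝ E
  𝔥 : Submodule ℝ E
  isCompl : IsCompl V 𝔥
  mul_mem : ∀ᶠ p in 𝓝 ((0, 0) : 𝔥 × 𝔥), G.mul (p.1 : E) (p.2 : E) ∈ 𝔥
  φ : V → 𝔥
  contDiffAt_φ : ContDiffAt ℝ ∞ φ 0
  φ_zero : φ 0 = 0
  fderiv_φ_zero : fderiv ℝ φ 0 = 0

namespace EmbeddedLoop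

variable {E : Type*} [NormedAddCommGroup E] [NormedSpace ℝ E] (L : EmbeddedLoop E)

/-- The linear projection `Π : 𝔤 → V` parallel to `𝔥`. -/
def proj : E →ₗ[ℝ] L.V := Submodule.projectionOnto L.V L.𝔥 L.isCompl

/-- The symmetric bilinear map `R` with `φ ξ = R (ξ, ξ) + o(‖ξ‖²)`: half of the second derivative of
`φ` at `0`. -/
def R (ξ η : L.V) : L.𝔥 := (1 / 2 : ℝ) • fderiv ℝ (fderiv ℝ L.φ) 0 ξ η

/-- The point of `Q` with coordinate `ξ`. -/
def sec (ξ : L.V) : E := (ξ : E) + (L.φ ξ : E)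

/-- The map `Q × H → G`, `(q, h) ↦ q h`, in the coordinates of `Q` and `H`. -/
def secMul (p : L.V × L.𝔥) : E := L.G.mul (L.sec p.1) (p.2 : E)

theorem sec_zero : L.sec 0 = 0 := by simp [sec, L.φ_zero]

theorem contDiffAt_sec : ContDiffAt ℝ ∞ L.sec 0 :=
  L.V.subtypeL.contDiff.contDiffAt.add
    (L.𝔥.subtypeL.contDiff.contDiffAt.comp (0 : L.V) L.contDiffAt_φ)

theorem contDiffAt_secMul : ContDiffAt ℝ ∞ L.secMul 0 := by
  have h1 : ContDiffAt ℝ ∞ (fun p : L.V × L.𝔥 => L.sec p.1) 0 :=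
    ContDiffAt.comp (0 : L.V × L.𝔥) (g := L.sec) (f := Prod.fst) L.contDiffAt_sec contDiffAt_fst
  have h2 : ContDiffAt ℝ ∞ (fun p : L.V × L.𝔥 => (p.2 : E)) 0 :=
    ContDiffAt.comp (0 : L.V × L.𝔥) (g := fun h : L.𝔥 => (h : E)) (f := Prod.snd)
      L.𝔥.subtypeL.contDiff.contDiffAt contDiffAt_snd
  have h3 := L.G.contDiffAt_mul
  refine ContDiffAt.comp (0 : L.V × L.𝔥) (g := fun p : E × E => L.G.mul p.1 p.2)
    (f := fun p : L.V × L.𝔥 => (L.sec p.1, (p.2 : E))) ?_ (h1.prodMk h2)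
  simpa [L.sec_zero] using h3

theorem hasFDerivAt_sec : HasFDerivAt L.sec L.V.subtypeL 0 := by
  have h1 : HasFDerivAt L.φ (0 : L.V →L[ℝ] L.𝔥) 0 := by
    rw [← L.fderiv_φ_zero]
    exact (L.contDiffAt_φ.differentiableAt (by simp)).hasFDerivAt
  have h2 := (L.V.subtypeL.hasFDerivAt (x := (0 : L.V))).add
    ((L.𝔥.subtypeL.hasFDerivAt (x := L.φ 0)).comp (0 : L.V) h1)
  rw [ContinuousLinearMap.comp_zero, add_zero] at h2
  exact h2

theorem hasFDerivAt_mul (G : LocalLieGroup E) :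
    HasFDerivAt (fun p : E × E => G.mul p.1 p.2)
      (ContinuousLinearMap.fst ℝ E E + ContinuousLinearMap.snd ℝ E E) (0, 0) := by
  have h := (G.contDiffAt_mul.differentiableAt (by simp)).hasFDerivAt
  set D := fderiv ℝ (fun p : E × E => G.mul p.1 p.2) (0, 0)
  have hl : D.comp (ContinuousLinearMap.inl ℝ E E) = ContinuousLinearMap.id ℝ E := by
    have h1 : HasFDerivAt (fun x : E => G.mul x 0) (D.comp (ContinuousLinearMap.inl ℝ E E)) 0 :=
      HasFDerivAt.comp (0 : E) (g := fun p : E × E => G.mul p.1 p.2) (f := fun x : E => (x, (0 : E)))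
        h (ContinuousLinearMap.inl ℝ E E).hasFDerivAt
    exact h1.unique ((hasFDerivAt_id (0 : E)).congr_of_eventuallyEq G.mul_zero)
  have hr : D.comp (ContinuousLinearMap.inr ℝ E E) = ContinuousLinearMap.id ℝ E := by
    have h1 : HasFDerivAt (fun x : E => G.mul 0 x) (D.comp (ContinuousLinearMap.inr ℝ E E)) 0 :=
      HasFDerivAt.comp (0 : E) (g := fun p : E × E => G.mul p.1 p.2) (f := fun x : E => ((0 : E), x))
        h (ContinuousLinearMap.inr ℝ E E).hasFDerivAt
    exact h1.unique ((hasFDerivAt_id (0 : E)).congr_of_eventuallyEq G.zero_mul)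
  have hD : D = ContinuousLinearMap.fst ℝ E E + ContinuousLinearMap.snd ℝ E E := by
    ext x
    · simpa using congrArg (fun f => f x) hl
    · simpa using congrArg (fun f => f x) hr
  rwa [hD] at h

variable [FiniteDimensional ℝ E]

/-- The identification `V × 𝔥 ≃ E`, `(ξ, h) ↦ ξ + h`. -/
def decomp : (L.V × L.𝔥) ≃L[ℝ] E :=
  (Submodule.prodEquivOfIsCompl L.V L.𝔥 L.isCompl).toContinuousLinearEquiv

theorem hasFDerivAt_secMul :
    HasFDerivAt L.secMul (L.decomp : (L.V × L.𝔥) →L[ℝ] E) 0 := by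
  have h1 : HasFDerivAt (fun p : L.V × L.𝔥 => (L.sec p.1, (p.2 : E)))
      ((L.V.subtypeL.comp (ContinuousLinearMap.fst ℝ L.V L.𝔥)).prod
        (L.𝔥.subtypeL.comp (ContinuousLinearMap.snd ℝ L.V L.𝔥))) 0 :=
    (HasFDerivAt.comp (0 : L.V × L.𝔥) (g := L.sec) (f := Prod.fst)
      L.hasFDerivAt_sec hasFDerivAt_fst).prodMk
      (L.𝔥.subtypeL.comp (ContinuousLinearMap.snd ℝ L.V L.𝔥)).hasFDerivAt
  have h2 : HasFDerivAt (fun p : E × E => L.G.mul p.1 p.2)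
      (ContinuousLinearMap.fst ℝ E E + ContinuousLinearMap.snd ℝ E E)
      ((fun p : L.V × L.𝔥 => (L.sec p.1, (p.2 : E))) 0) := by
    simpa [L.sec_zero] using hasFDerivAt_mul L.G
  have h3 := HasFDerivAt.comp (0 : L.V × L.𝔥) h2 h1
  have h4 : (ContinuousLinearMap.fst ℝ E E + ContinuousLinearMap.snd ℝ E E).comp
      ((L.V.subtypeL.comp (ContinuousLinearMap.fst ℝ L.V L.𝔥)).prod
        (L.𝔥.subtypeL.comp (ContinuousLinearMap.snd ℝ L.V L.𝔥)))
      = (L.decomp : (L.V × L.𝔥) →L[ℝ] E) := by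
    refine ContinuousLinearMap.ext fun x => ?_
    change (x.1 : E) + (x.2 : E) = Submodule.prodEquivOfIsCompl L.V L.𝔥 L.isCompl x
    exact (Submodule.coe_prodEquivOfIsCompl' _ _ L.isCompl x).symm
  rw [h4] at h3
  exact h3

/-- The projection `Π_Q : G → Q` parallel to `H`, in the coordinates of `Q`: near the identity every
`g` is uniquely of the form `q h` with `q ∈ Q`, `h ∈ H`, and `projQ g` is the coordinate of `q`. -/
def projQ (g : E) : L.V :=
  haveI : CompleteSpace (L.V × L.𝔥) := FiniteDimensional.complete ℝ (L.V × L.𝔥)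
  (L.contDiffAt_secMul.localInverse L.hasFDerivAt_secMul (by simp) g).1

/-- The loop product `x × y = Π_Q (x · y)` on `Q`, in the coordinates of `Q`. -/
def loopMul (x y : L.V) : L.V := L.projQ (L.G.mul (L.sec x) (L.sec y))

end EmbeddedLoop

end

/-!
The loop product is the action of the section `Q` on `G / H`, read in the coordinates of `Q`, so it
solves Lie's equation `∂μ/∂x = A (μ) ∘ θ (x)`, where `A` is the infinitesimal action of `𝔤` and `θ`
the right logarithmic derivative of the section. Hence the connection involves only `A'` and `θ`,
and the diagonal `b (ξ, ξ, ξ)` of the curvature only sees the second derivative of the section,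
pushed into the stabilizer `ker A (μ)` of the point `μ`. Since `A` is a morphism of Lie algebras up
to sign, applying `A'` to the stabilizer is taking a bracket: on the leaf `x = 0` the value of
`b (ξ, ξ, ξ)` is `-A [K, v]`, where `K` is the stabilizer component of the second derivative of the
section. At the base point `A = Π` and `K = 2 R (ξ, ξ)`, which gives the first identity;
differentiating along the leaf, where `K` moves with the stabilizer, gives the second one.
Polarization turns both diagonal identities into cyclic sums.
-/

section Inverse

variable {𝕜 X E F : Type*} [NontriviallyNormedField 𝕜] [NormedAddCommGroup X] [NormedSpace 𝕜 X]
  [NormedAddCommGroup E] [NormedSpace 𝕜 E] [NormedAddCommGroup F] [NormedSpace 𝕜 F]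

theorem eventually_isInvertible [CompleteSpace E] {T : E →L[𝕜] F} (hT : T.IsInvertible) :
    ∀ᶠ S in 𝓝 T, S.IsInvertible := by
  obtain ⟨e, rfl⟩ := hT
  exact e.nhds

theorem hasFDerivAt_inverse_apply [CompleteSpace E] {T : X → E →L[𝕜] F} {T' : X →L[𝕜] E →L[𝕜] F}
    {p : X} (hT : HasFDerivAt T T' p) (hp : (T p).IsInvertible) (ξ : F) :
    HasFDerivAt (fun q => (T q).inverse ξ) (-((T p).inverse ∘L T'.flip ((T p).inverse ξ))) p := by
  have hd : DifferentiableAt 𝕜 (fun q => (T q).inverse ξ) p :=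
    ((hp.contDiffAt_map_inverse.differentiableAt one_ne_zero).comp p hT.differentiableAt).clm_apply
      (differentiableAt_const ξ)
  have product_rule := hT.clm_apply hd.hasFDerivAt
  have const : HasFDerivAt (fun q => T q ((T q).inverse ξ)) (0 : X →L[𝕜] F) p := by
    refine (hasFDerivAt_const ξ p).congr_of_eventuallyEq ?_
    filter_upwards [hT.continuousAt.eventually (eventually_isInvertible hp)] with q hq
    exact hq.self_apply_inverse ξ
  convert hd.hasFDerivAt using 1
  ext w
  have := congr((T p).inverse ($(product_rule.unique const) w))
  simp only [add_apply, ContinuousLinearMap.comp_apply, map_add, hp.inverse_apply_self,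
    zero_apply, map_zero] at this
  exact (eq_neg_of_add_eq_zero_left this).symm

end Inverse

section SymmetricTrilinear

variable {A B : Type*} [AddCommGroup A] [AddCommGroup B] {f : A → A → A → B}

theorem sum_perm_eq_zero_of_diag (h₁ : ∀ a a' b c, f (a + a') b c = f a b c + f a' b c)
    (h₂ : ∀ a b b' c, f a (b + b') c = f a b c + f a b' c)
    (h₃ : ∀ a b c c', f a b (c + c') = f a b c + f a b c')
    (h : ∀ a, f a a a = 0) (x y z : A) :
    f x y z + f y z x + f z x y + f y x z + f x z y + f z y x = 0 := by
  have polarization : f x y z + f y z x + f z x y + f y x z + f x z y + f z y x =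
      f (x + y + z) (x + y + z) (x + y + z) - f (x + y) (x + y) (x + y)
        - f (y + z) (y + z) (y + z) - f (x + z) (x + z) (x + z)
        + f x x x + f y y y + f z z z := by
    simp only [h₁, h₂, h₃]
    abel
  simp [polarization, h]

theorem forall_diag_eq_zero_iff_cyclic_sum_eq_zero [Module ℝ B]
    (hf : ∀ a b c, f a b c = f b a c) (h₂ : ∀ a b b' c, f a (b + b') c = f a b c + f a b' c)
    (h₃ : ∀ a b c c', f a b (c + c') = f a b c + f a b c') :
    (∀ a, f a a a = 0) ↔ ∀ x y z, f x y z + f y z x + f z x y = 0 := by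
  refine ⟨fun H x y z => ?_, fun H a => ?_⟩
  · have h₁ (a a' b c) : f (a + a') b c = f a b c + f a' b c := by rw [hf, h₂, hf, hf b]
    have := sum_perm_eq_zero_of_diag h₁ h₂ h₃ H x y z
    rw [hf y x, hf x z, hf z y] at this
    linear_combination (norm := module) (1 / 2 : ℝ) • this
  · linear_combination (norm := module) (1 / 3 : ℝ) • H a a a

end SymmetricTrilinear

/-! ### The curvature of the web of a local loop -/

namespace ThreeWeb

variable {F : Type*} [NormedAddCommGroup F] [NormedSpace ℝ F] {μ : F → F → F} {p : F × F}
  {m n : WithTop ℕ∞}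

theorem sym₃_diag (f : F → F → F → F) (ξ : F) : sym₃ f ξ ξ ξ = f ξ ξ ξ := by
  unfold sym₃
  module

/-- The loop product `μ` is of class `C^n` near `p`, and its three families of leaves are pairwise
transverse at `p`. -/
structure RegularAt (n : WithTop ℕ∞) (μ : F → F → F) (p : F × F) : Prop where
  contDiffAt : ContDiffAt ℝ n (fun q : F × F => μ q.1 q.2) p
  isInvertible_P : (P μ p).IsInvertible
  isInvertible_Q : (Q μ p).IsInvertible

theorem P_eq_fderiv_comp_inl (hμ : DifferentiableAt ℝ (fun q : F × F => μ q.1 q.2) p) :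
    P μ p = fderiv ℝ (fun q : F × F => μ q.1 q.2) p ∘L ContinuousLinearMap.inl ℝ F F :=
  (HasFDerivAt.comp (f := fun x => (x, p.2)) p.1 hμ.hasFDerivAt
    (hasFDerivAt_prodMk_left p.1 p.2)).fderiv

theorem Q_eq_fderiv_comp_inr (hμ : DifferentiableAt ℝ (fun q : F × F => μ q.1 q.2) p) :
    Q μ p = fderiv ℝ (fun q : F × F => μ q.1 q.2) p ∘L ContinuousLinearMap.inr ℝ F F :=
  (HasFDerivAt.comp (f := fun y => (p.1, y)) p.2 hμ.hasFDerivAt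
    (hasFDerivAt_prodMk_right p.1 p.2)).fderiv

theorem hasFDerivAt_coprod (hμ : DifferentiableAt ℝ (fun q : F × F => μ q.1 q.2) p) :
    HasFDerivAt (fun q : F × F => μ q.1 q.2) ((P μ p).coprod (Q μ p)) p := by
  refine hμ.hasFDerivAt.congr_fderiv ?_
  rw [P_eq_fderiv_comp_inl hμ, Q_eq_fderiv_comp_inr hμ]
  ext <;> simp

theorem contDiffAt_P (hμ : ContDiffAt ℝ n (fun q : F × F => μ q.1 q.2) p) (hmn : m + 1 ≤ n) :
    ContDiffAt ℝ m (P μ) p :=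
  ContDiffAt.fderiv (f := fun (q : F × F) x => μ x q.2) (g := Prod.fst)
    (hμ.comp (p, p.1) (contDiffAt_snd.prodMk (contDiffAt_fst.snd))) contDiffAt_fst hmn

theorem contDiffAt_Q (hμ : ContDiffAt ℝ n (fun q : F × F => μ q.1 q.2) p) (hmn : m + 1 ≤ n) :
    ContDiffAt ℝ m (Q μ) p :=
  ContDiffAt.fderiv (f := fun (q : F × F) y => μ q.1 y) (g := Prod.snd)
    (hμ.comp (p, p.2) (contDiffAt_fst.fst.prodMk contDiffAt_snd)) contDiffAt_snd hmn

theorem contDiffAt_mixedDeriv (hμ : ContDiffAt ℝ n (fun q : F × F => μ q.1 q.2) p)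
    (hmn : m + 2 ≤ n) : ContDiffAt ℝ m (mixedDeriv μ) p :=
  ContDiffAt.fderiv (n := m + 1) (f := fun (q : F × F) x => Q μ (x, q.2)) (g := Prod.fst)
    ((contDiffAt_Q hμ (by rwa [add_assoc, one_add_one_eq_two])).comp (p, p.1)
      (contDiffAt_snd.prodMk contDiffAt_fst.snd)) contDiffAt_fst le_rfl

theorem mixedDeriv_eq_fderiv_Q (hμ : ContDiffAt ℝ 2 (fun q : F × F => μ q.1 q.2) p) (v : F) :
    mixedDeriv μ p v = fderiv ℝ (Q μ) p (v, 0) := by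
  have hQ : DifferentiableAt ℝ (Q μ) p :=
    (contDiffAt_Q (m := 1) hμ one_add_one_eq_two.le).differentiableAt one_ne_zero
  have := HasFDerivAt.comp (f := fun x => (x, p.2)) p.1 hQ.hasFDerivAt
    (hasFDerivAt_prodMk_left p.1 p.2)
  exact congr($(this.fderiv) v)

theorem mixedDeriv_apply_eq_fderiv_P (hμ : ContDiffAt ℝ 2 (fun q : F × F => μ q.1 q.2) p)
    (v w : F) : mixedDeriv μ p v w = fderiv ℝ (P μ) p (0, w) v := by
  set f : F × F → F := fun q => μ q.1 q.2
  have hf : ∀ᶠ q in 𝓝 p, DifferentiableAt ℝ f q :=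
    (hμ.eventually (by simp)).mono fun q hq => hq.differentiableAt two_ne_zero
  have hP : P μ =ᶠ[𝓝 p] fun q => fderiv ℝ f q ∘L ContinuousLinearMap.inl ℝ F F :=
    hf.mono fun q hq => P_eq_fderiv_comp_inl hq
  have hQ : Q μ =ᶠ[𝓝 p] fun q => fderiv ℝ f q ∘L ContinuousLinearMap.inr ℝ F F :=
    hf.mono fun q hq => Q_eq_fderiv_comp_inr hq
  have hf' : HasFDerivAt (fderiv ℝ f) (fderiv ℝ (fderiv ℝ f) p) p :=
    ((hμ.fderiv_right (m := 1) one_add_one_eq_two.le).differentiableAt one_ne_zero).hasFDerivAt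
  rw [mixedDeriv_eq_fderiv_Q hμ, hP.fderiv_eq, hQ.fderiv_eq,
    (hf'.clm_comp (hasFDerivAt_const _ p)).fderiv, (hf'.clm_comp (hasFDerivAt_const _ p)).fderiv]
  simpa using (hμ.isSymmSndFDerivAt (by simp)).eq (v, 0) (0, w)

theorem RegularAt.eventually [CompleteSpace F] (h : RegularAt n μ p) (hn : n ≠ ∞) (h1 : 1 ≤ n) :
    ∀ᶠ q in 𝓝 p, RegularAt n μ q := by
  have hP := (contDiffAt_P (m := 0) h.contDiffAt (by simpa)).continuousAt
  have hQ := (contDiffAt_Q (m := 0) h.contDiffAt (by simpa)).continuousAt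
  filter_upwards [h.contDiffAt.eventually hn,
    hP.eventually (eventually_isInvertible h.isInvertible_P),
    hQ.eventually (eventually_isInvertible h.isInvertible_Q)] with q hμ hP hQ
  exact ⟨hμ, hP, hQ⟩

theorem frame₁_add (ξ η : F) : frame₁ μ p (ξ + η) = frame₁ μ p ξ + frame₁ μ p η := by
  simp [frame₁]

theorem frame₂_add (ξ η : F) : frame₂ μ p (ξ + η) = frame₂ μ p ξ + frame₂ μ p η := by
  simp [frame₂]

theorem conn_add_left (X Y : F × F) (ξ : F) :
    conn μ p (X + Y) ξ = conn μ p X ξ + conn μ p Y ξ := by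
  simp only [conn, Gam, Prod.fst_add, Prod.snd_add, map_add, add_apply]
  abel

theorem conn_add_right (X : F × F) (ξ η : F) :
    conn μ p X (ξ + η) = conn μ p X ξ + conn μ p X η := by
  simp only [conn, Gam, map_add, add_apply]
  abel

theorem conn_smul_right (X : F × F) (c : ℝ) (ξ : F) :
    conn μ p X (c • ξ) = c • conn μ p X ξ := by
  simp only [conn, Gam, map_smul, smul_apply, smul_add, smul_neg]

section Smoothness

variable [CompleteSpace F] {T : Type*} [NormedAddCommGroup T] [NormedSpace ℝ T] {t : T}
  {f X : T → F × F} {ξ η ζ : T → F}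

theorem RegularAt.contDiffAt_inverse_P (h : RegularAt n μ (f t)) (hmn : m + 1 ≤ n)
    (hf : ContDiffAt ℝ m f t) : ContDiffAt ℝ m (fun s => (P μ (f s)).inverse) t :=
  ContDiffAt.comp (f := fun s => P μ (f s)) t h.isInvertible_P.contDiffAt_map_inverse
    ((contDiffAt_P h.contDiffAt hmn).comp t hf)

theorem RegularAt.contDiffAt_inverse_Q (h : RegularAt n μ (f t)) (hmn : m + 1 ≤ n)
    (hf : ContDiffAt ℝ m f t) : ContDiffAt ℝ m (fun s => (Q μ (f s)).inverse) t :=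
  ContDiffAt.comp (f := fun s => Q μ (f s)) t h.isInvertible_Q.contDiffAt_map_inverse
    ((contDiffAt_Q h.contDiffAt hmn).comp t hf)

theorem RegularAt.contDiffAt_conn (h : RegularAt n μ (f t)) (hmn : m + 2 ≤ n)
    (hf : ContDiffAt ℝ m f t) (hX : ContDiffAt ℝ m X t) (hξ : ContDiffAt ℝ m ξ t) :
    ContDiffAt ℝ m (fun s => conn μ (f s) (X s) (ξ s)) t := by
  have hmn' : m + 1 ≤ n := le_trans (by gcongr; norm_num) hmn
  have hP := (contDiffAt_P h.contDiffAt hmn').comp t hf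
  have hQ := (contDiffAt_Q h.contDiffAt hmn').comp t hf
  have hP' := h.contDiffAt_inverse_P hmn' hf
  have hQ' := h.contDiffAt_inverse_Q hmn' hf
  have hμ := (contDiffAt_mixedDeriv h.contDiffAt hmn).comp t hf
  have hGam {ξ η : T → F} (hξ : ContDiffAt ℝ m ξ t) (hη : ContDiffAt ℝ m η t) :
      ContDiffAt ℝ m (fun s => Gam μ (f s) (ξ s) (η s)) t :=
    ((hμ.clm_apply (hP'.clm_apply hξ)).clm_apply (hQ'.clm_apply hη)).neg
  exact (hGam (hP.clm_apply hX.fst) hξ).add (hGam hξ (hQ.clm_apply hX.snd))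

theorem RegularAt.contDiffAt_frame₁ (h : RegularAt n μ p) (hmn : m + 1 ≤ n) (η : F) :
    ContDiffAt ℝ m (fun q => frame₁ μ q η) p :=
  ((h.contDiffAt_inverse_P (f := id) hmn contDiffAt_id).clm_apply contDiffAt_const).prodMk
    contDiffAt_const

theorem RegularAt.contDiffAt_frame₂ (h : RegularAt n μ p) (hmn : m + 1 ≤ n) (ζ : F) :
    ContDiffAt ℝ m (fun q => frame₂ μ q ζ) p :=
  contDiffAt_const.prodMk
    ((h.contDiffAt_inverse_Q (f := id) hmn contDiffAt_id).clm_apply contDiffAt_const)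

theorem RegularAt.contDiffAt_fderiv_conn {X Y : F × F → F × F} (h : RegularAt n μ p)
    (hmn : m + 3 ≤ n) (hX : ContDiffAt ℝ (m + 1) X p) (hY : ContDiffAt ℝ m Y p) (ξ : F) :
    ContDiffAt ℝ m (fun q => fderiv ℝ (fun q' => conn μ q' (X q) ξ) q (Y q)) p := by
  have hmn' : m + 1 + 2 ≤ n := by rwa [add_assoc, show (1 + 2 : WithTop ℕ∞) = 3 by norm_num]
  refine ContDiffAt.clm_apply (ContDiffAt.fderiv (n := m + 1) (g := id)
    (f := fun q q' => conn μ q' (X q) ξ) ?_ contDiffAt_id le_rfl) hY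
  exact h.contDiffAt_conn (f := Prod.snd) (t := (p, p)) hmn' contDiffAt_snd
    (hX.comp (p, p) contDiffAt_fst) contDiffAt_const

theorem RegularAt.contDiffAt_b (h : RegularAt n μ p) (hmn : m + 3 ≤ n) (ξ η ζ : F) :
    ContDiffAt ℝ m (fun q => b μ q ξ η ζ) p := by
  have hmn₂ : m + 2 ≤ n := le_trans (by gcongr; norm_num) hmn
  have hmn₂' : m + 1 + 1 ≤ n := by rwa [add_assoc, one_add_one_eq_two]
  have hmn₁ : m + 1 ≤ n := le_self_add.trans hmn₂'
  have hconn {X : F × F → F × F} {ξ : F × F → F} (hX : ContDiffAt ℝ m X p)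
      (hξ : ContDiffAt ℝ m ξ p) := h.contDiffAt_conn (f := id) hmn₂ contDiffAt_id hX hξ
  have h₁ := h.contDiffAt_frame₁ hmn₁ η
  have h₂ := h.contDiffAt_frame₂ hmn₁ ζ
  have h₁' := h.contDiffAt_frame₁ hmn₂' η
  have h₂' := h.contDiffAt_frame₂ hmn₂' ζ
  exact ((h.contDiffAt_fderiv_conn hmn h₂' h₁ ξ).sub (h.contDiffAt_fderiv_conn hmn h₁' h₂ ξ)).sub
    ((hconn h₂ (hconn h₁ contDiffAt_const)).sub (hconn h₁ (hconn h₂ contDiffAt_const)))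

end Smoothness

theorem RegularAt.differentiableAt_conn [CompleteSpace F] (h : RegularAt 3 μ p) (X : F × F)
    (ξ : F) : DifferentiableAt ℝ (fun q => conn μ q X ξ) p :=
  (h.contDiffAt_conn (f := id) (m := 1) (by norm_num) contDiffAt_id contDiffAt_const
    contDiffAt_const).differentiableAt one_ne_zero

theorem RegularAt.differentiableAt_b [CompleteSpace F] (h : RegularAt 4 μ p) (ξ η ζ : F) :
    DifferentiableAt ℝ (fun q => b μ q ξ η ζ) p :=
  (h.contDiffAt_b (m := 1) (by norm_num) ξ η ζ).differentiableAt one_ne_zero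

section Additivity

variable [CompleteSpace F] (h : RegularAt 3 μ p)
include h

theorem RegularAt.fderiv_conn_add_left (X X' Y : F × F) (ξ : F) :
    fderiv ℝ (fun q => conn μ q (X + X') ξ) p Y =
      fderiv ℝ (fun q => conn μ q X ξ) p Y + fderiv ℝ (fun q => conn μ q X' ξ) p Y := by
  simp only [conn_add_left]
  rw [fderiv_fun_add (h.differentiableAt_conn X ξ) (h.differentiableAt_conn X' ξ), add_apply]

theorem RegularAt.fderiv_conn_add_right (X Y : F × F) (ξ ξ' : F) :
    fderiv ℝ (fun q => conn μ q X (ξ + ξ')) p Y =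
      fderiv ℝ (fun q => conn μ q X ξ) p Y + fderiv ℝ (fun q => conn μ q X ξ') p Y := by
  simp only [conn_add_right]
  rw [fderiv_fun_add (h.differentiableAt_conn X ξ) (h.differentiableAt_conn X ξ'), add_apply]

theorem RegularAt.b_add_left (ξ ξ' η ζ : F) :
    b μ p (ξ + ξ') η ζ = b μ p ξ η ζ + b μ p ξ' η ζ := by
  rw [b, b, b, h.fderiv_conn_add_right, h.fderiv_conn_add_right]
  simp only [conn_add_right]
  abel

theorem RegularAt.b_add_middle (ξ η η' ζ : F) :
    b μ p ξ (η + η') ζ = b μ p ξ η ζ + b μ p ξ η' ζ := by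
  rw [b, b, b, frame₁_add, h.fderiv_conn_add_left, map_add]
  simp only [conn_add_left, conn_add_right]
  abel

theorem RegularAt.b_add_right (ξ η ζ ζ' : F) :
    b μ p ξ η (ζ + ζ') = b μ p ξ η ζ + b μ p ξ η ζ' := by
  rw [b, b, b, frame₂_add, h.fderiv_conn_add_left, map_add]
  simp only [conn_add_left, conn_add_right]
  abel

theorem RegularAt.symBVanishesAt_iff : SymBVanishesAt μ p ↔ ∀ ξ, b μ p ξ ξ ξ = 0 := by
  refine ⟨fun H ξ => (sym₃_diag (b μ p) ξ).symm.trans (H ξ ξ ξ), fun H ξ η ζ => ?_⟩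
  rw [sym₃, sum_perm_eq_zero_of_diag h.b_add_left h.b_add_middle h.b_add_right H, smul_zero]

end Additivity

/-- The connection terms of the covariant derivative drop out where the tensor itself vanishes. -/
theorem SymBVanishesAt.sym₃_d [CompleteSpace F] (H : SymBVanishesAt μ p) (h : RegularAt 4 μ p)
    (ξ η ζ τ : F) :
    sym₃ (fun ξ η ζ => d μ p ξ η ζ τ) ξ η ζ =
      fderiv ℝ (fun q => sym₃ (b μ q) ξ η ζ) p (frame₂ μ p τ) := by
  have hb (ξ η ζ : F) := (h.differentiableAt_b ξ η ζ).hasFDerivAt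
  have hsym : HasFDerivAt (fun q => sym₃ (b μ q) ξ η ζ) _ p :=
    ((((((hb ξ η ζ).add (hb η ζ ξ)).add (hb ζ ξ η)).add (hb η ξ ζ)).add (hb ξ ζ η)).add
      (hb ζ η ξ)).const_smul (1 / 6 : ℝ)
  rw [hsym.fderiv]
  have h₀ : conn μ p (frame₂ μ p τ) (sym₃ (b μ p) ξ η ζ) = 0 := by
    simpa [H ξ η ζ] using conn_smul_right (frame₂ μ p τ) 0 (0 : F)
  have h₁ := H (conn μ p (frame₂ μ p τ) ξ) η ζ
  have h₂ := H ξ (conn μ p (frame₂ μ p τ) η) ζ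
  have h₃ := H ξ η (conn μ p (frame₂ μ p τ) ζ)
  simp only [sym₃, conn_smul_right, conn_add_right] at h₀ h₁ h₂ h₃
  simp only [sym₃, d, add_apply, smul_apply]
  linear_combination (norm := module) h₀ - h₁ - h₂ - h₃

theorem IsHexagonal.symDVanishesAt [CompleteSpace F] (H : IsHexagonal μ)
    (h : RegularAt 4 μ (0, 0)) : SymDVanishesAt μ (0, 0) := by
  intro ξ η ζ τ
  have vanish : (fun q => sym₃ (b μ q) ξ η ζ) =ᶠ[𝓝 (0, 0)] fun _ => 0 := H.mono fun q hq => hq ξ η ζ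
  simp [H.self_of_nhds.sym₃_d h, vanish.fderiv_eq]

end ThreeWeb

/-! ### Loops solving Lie's equation -/

section KerProj

variable {𝕜 E F : Type*} [NontriviallyNormedField 𝕜] [NormedAddCommGroup E]
  [NormedSpace 𝕜 E] [NormedAddCommGroup F] [NormedSpace 𝕜 F]

/-- For `T : E → F` and `ι : F → E` with `T ∘ ι` invertible, the projection of `E` onto the kernel
of `T` parallel to the range of `ι`. -/
noncomputable def kerProj (T : E →L[𝕜] F) (ι : F →L[𝕜] E) : E →L[𝕜] E :=
  ContinuousLinearMap.id 𝕜 E - ι ∘L (T ∘L ι).inverse ∘L T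

theorem kerProj_apply (T : E →L[𝕜] F) (ι : F →L[𝕜] E) (X : E) :
    kerProj T ι X = X - ι ((T ∘L ι).inverse (T X)) := rfl

theorem apply_kerProj {T : E →L[𝕜] F} {ι : F →L[𝕜] E} (h : (T ∘L ι).IsInvertible) (X : E) :
    T (kerProj T ι X) = 0 := by
  rw [kerProj_apply, map_sub, sub_eq_zero]
  exact (h.self_apply_inverse (T X)).symm

theorem hasFDerivAt_kerProj_apply [CompleteSpace F] {Z : Type*} [NormedAddCommGroup Z]
    [NormedSpace 𝕜 Z] {T : Z → E →L[𝕜] F} {T' : Z →L[𝕜] E →L[𝕜] F} {z : Z} {ι : F →L[𝕜] E} {X : E}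
    (hT : HasFDerivAt T T' z) (h : (T z ∘L ι).IsInvertible) (hX : T z X = 0) :
    HasFDerivAt (fun y => kerProj (T y) ι X) (-(ι ∘L (T z ∘L ι).inverse ∘L T'.flip X)) z := by
  have hTι : DifferentiableAt 𝕜 (fun y => T y ∘L ι) z :=
    hT.differentiableAt.clm_comp (differentiableAt_const ι)
  have hinv : DifferentiableAt 𝕜 (fun y => (T y ∘L ι).inverse) z :=
    .comp (f := fun y => T y ∘L ι) z (h.contDiffAt_map_inverse.differentiableAt one_ne_zero) hTι
  refine ((ι.hasFDerivAt.comp z (hinv.hasFDerivAt.clm_apply (hT.clm_apply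
    (hasFDerivAt_const X z)))).const_sub X).congr_fderiv ?_
  ext w
  simp [hX]

end KerProj

namespace ThreeWeb

variable {E F : Type*} [NormedAddCommGroup E] [NormedSpace ℝ E] [NormedAddCommGroup F]
  [NormedSpace ℝ F]

/-- Near `p` the loop product solves Lie's equation `∂μ/∂x = A (μ) ∘ θ x`.  For a loop of
transformations `x ↦ s x` in a Lie group `G`, `A z` is the infinitesimal action of `Lie G` at `z`,
and `θ` is the right logarithmic derivative of `s`. -/
structure SolvesLieEquationAt (μ : F → F → F) (A : F → E →L[ℝ] F) (θ : F → F →L[ℝ] E)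
    (p : F × F) : Prop where
  regularAt : RegularAt 3 μ p
  contDiffAt_A : ContDiffAt ℝ 2 A (μ p.1 p.2)
  contDiffAt_θ : ContDiffAt ℝ 1 θ p.1
  P_eq : ∀ᶠ q in 𝓝 p, P μ q = A (μ q.1 q.2) ∘L θ q.1

namespace SolvesLieEquationAt

variable {μ : F → F → F} {A : F → E →L[ℝ] F} {θ : F → F →L[ℝ] E} {p : F × F}
  (h : SolvesLieEquationAt μ A θ p)
include h

theorem hasFDerivAt_μ :
    HasFDerivAt (fun q : F × F => μ q.1 q.2) ((P μ p).coprod (Q μ p)) p :=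
  hasFDerivAt_coprod (h.regularAt.contDiffAt.differentiableAt three_ne_zero)

theorem hasFDerivAt_A : HasFDerivAt (fun q : F × F => A (μ q.1 q.2))
    (fderiv ℝ A (μ p.1 p.2) ∘L (P μ p).coprod (Q μ p)) p :=
  (h.contDiffAt_A.differentiableAt two_ne_zero).hasFDerivAt.comp p h.hasFDerivAt_μ

theorem hasFDerivAt_fderiv_A : HasFDerivAt (fun q : F × F => fderiv ℝ A (μ q.1 q.2))
    (fderiv ℝ (fderiv ℝ A) (μ p.1 p.2) ∘L (P μ p).coprod (Q μ p)) p :=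
  HasFDerivAt.comp (g := fderiv ℝ A) p ((h.contDiffAt_A.fderiv_right (m := 1)
    one_add_one_eq_two.le).differentiableAt one_ne_zero).hasFDerivAt h.hasFDerivAt_μ

theorem hasFDerivAt_θ : HasFDerivAt (fun q : F × F => θ q.1)
    (fderiv ℝ θ p.1 ∘L ContinuousLinearMap.fst ℝ F F) p :=
  (h.contDiffAt_θ.differentiableAt one_ne_zero).hasFDerivAt.comp p hasFDerivAt_fst

theorem hasFDerivAt_P : HasFDerivAt (P μ) (fderiv ℝ (P μ) p) p :=
  ((contDiffAt_P (m := 1) h.regularAt.contDiffAt (by norm_num)).differentiableAt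
    one_ne_zero).hasFDerivAt

theorem fderiv_P_apply (X : F × F) (v : F) :
    fderiv ℝ (P μ) p X v = fderiv ℝ A (μ p.1 p.2) (P μ p X.1 + Q μ p X.2) (θ p.1 v)
      + A (μ p.1 p.2) (fderiv ℝ θ p.1 X.1 v) := by
  rw [((h.hasFDerivAt_A.clm_comp h.hasFDerivAt_θ).congr_of_eventuallyEq h.P_eq).fderiv]
  simp [add_comm]

theorem mixedDeriv_apply (v w : F) :
    mixedDeriv μ p v w = fderiv ℝ A (μ p.1 p.2) (Q μ p w) (θ p.1 v) := by
  rw [mixedDeriv_apply_eq_fderiv_P (h.regularAt.contDiffAt.of_le (by norm_num)), h.fderiv_P_apply]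
  simp

theorem conn_inl (u ξ : F) :
    conn μ p (u, 0) ξ = -fderiv ℝ A (μ p.1 p.2) ξ (θ p.1 u) := by
  simp [conn, Gam, h.mixedDeriv_apply, h.regularAt.isInvertible_P.inverse_apply_self,
    h.regularAt.isInvertible_Q.self_apply_inverse]

theorem conn_inr (w ξ : F) : conn μ p (0, w) ξ =
    -fderiv ℝ A (μ p.1 p.2) (Q μ p w) (θ p.1 ((P μ p).inverse ξ)) := by
  simp [conn, Gam, h.mixedDeriv_apply, h.regularAt.isInvertible_Q.inverse_apply_self]

variable [CompleteSpace F]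

theorem eventually : ∀ᶠ q in 𝓝 p, SolvesLieEquationAt μ A θ q := by
  have hμ : Tendsto (fun q : F × F => μ q.1 q.2) (𝓝 p) (𝓝 (μ p.1 p.2)) :=
    h.regularAt.contDiffAt.continuousAt
  filter_upwards [h.regularAt.eventually (by simp) (by norm_num),
    hμ.eventually (h.contDiffAt_A.eventually (by simp)),
    continuousAt_fst.eventually (h.contDiffAt_θ.eventually (by simp)),
    eventually_eventually_nhds.2 h.P_eq] with q hμ hA hθ hP
  exact ⟨hμ, hA, hθ, hP⟩

theorem fderiv_conn_inl (u ξ w : F) : fderiv ℝ (fun q => conn μ q (u, 0) ξ) p (0, w) =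
    -fderiv ℝ (fderiv ℝ A) (μ p.1 p.2) (Q μ p w) ξ (θ p.1 u) := by
  have hconn : (fun q => conn μ q (u, 0) ξ) =ᶠ[𝓝 p]
      fun q => -fderiv ℝ A (μ q.1 q.2) ξ (θ q.1 u) :=
    h.eventually.mono fun q hq => hq.conn_inl u ξ
  rw [hconn.fderiv_eq, fderiv_fun_neg,
    ((h.hasFDerivAt_fderiv_A.clm_apply (hasFDerivAt_const ξ p)).clm_apply
      (h.hasFDerivAt_θ.clm_apply (hasFDerivAt_const u p))).fderiv]
  simp

theorem fderiv_conn_inr (u w ξ : F) : fderiv ℝ (fun q => conn μ q (0, w) ξ) p (u, 0) =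
    -(fderiv ℝ (fderiv ℝ A) (μ p.1 p.2) (P μ p u) (Q μ p w) (θ p.1 ((P μ p).inverse ξ))
      + fderiv ℝ A (μ p.1 p.2) (mixedDeriv μ p u w) (θ p.1 ((P μ p).inverse ξ))
      + fderiv ℝ A (μ p.1 p.2) (Q μ p w) (fderiv ℝ θ p.1 u ((P μ p).inverse ξ)
        - θ p.1 ((P μ p).inverse (fderiv ℝ (P μ) p (u, 0) ((P μ p).inverse ξ))))) := by
  have hconn : (fun q => conn μ q (0, w) ξ) =ᶠ[𝓝 p]
      fun q => -fderiv ℝ A (μ q.1 q.2) (Q μ q w) (θ q.1 ((P μ q).inverse ξ)) :=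
    h.eventually.mono fun q hq => hq.conn_inr w ξ
  have hQ : HasFDerivAt (Q μ) (fderiv ℝ (Q μ) p) p :=
    ((contDiffAt_Q (m := 1) h.regularAt.contDiffAt (by norm_num)).differentiableAt
      one_ne_zero).hasFDerivAt
  have hP' := hasFDerivAt_inverse_apply h.hasFDerivAt_P h.regularAt.isInvertible_P ξ
  rw [mixedDeriv_eq_fderiv_Q (h.regularAt.contDiffAt.of_le (by norm_num)), hconn.fderiv_eq,
    fderiv_fun_neg,
    ((h.hasFDerivAt_fderiv_A.clm_apply (hQ.clm_apply (hasFDerivAt_const w p))).clm_apply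
      (h.hasFDerivAt_θ.clm_apply hP')).fderiv]
  simp only [ContinuousLinearMap.comp_neg, ContinuousLinearMap.comp_add, zero_add,
    ContinuousLinearMap.comp_zero, ContinuousLinearMap.flip_add, ContinuousLinearMap.flip_apply,
    ContinuousLinearMap.comp_apply, ContinuousLinearMap.coprod_apply, add_apply, neg_apply,
    ContinuousLinearMap.coe_fst', map_zero, add_zero, map_sub, neg_add_rev, neg_neg, neg_sub]
  abel

theorem b_diag (ξ : F) : b μ p ξ ξ ξ = -fderiv ℝ A (μ p.1 p.2) ξ
    (kerProj (A (μ p.1 p.2)) (θ p.1)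
      (fderiv ℝ θ p.1 ((P μ p).inverse ξ) ((P μ p).inverse ξ))) := by
  rw [b, frame₁, frame₂, h.fderiv_conn_inl, h.fderiv_conn_inr]
  simp only [h.conn_inl, h.conn_inr, h.mixedDeriv_apply, h.fderiv_P_apply, kerProj_apply,
    ← h.P_eq.self_of_nhds, h.regularAt.isInvertible_P.self_apply_inverse,
    h.regularAt.isInvertible_Q.self_apply_inverse, map_zero, add_zero, map_add, map_sub, map_neg,
    neg_apply]
  abel

end SolvesLieEquationAt

end ThreeWeb

/-! ### Actions of a local Lie group -/

namespace LocalLieGroup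

open ThreeWeb

variable {E : Type*} [NormedAddCommGroup E] [NormedSpace ℝ E] (G : LocalLieGroup E)

theorem P_mul_zero : P G.mul (0, 0) = ContinuousLinearMap.id ℝ E :=
  ((hasFDerivAt_id (0 : E)).congr_of_eventuallyEq G.mul_zero).fderiv

theorem contDiffAt_mul_two : ContDiffAt ℝ 2 (fun p : E × E => G.mul p.1 p.2) (0, 0) :=
  G.contDiffAt_mul.of_le ENat.LEInfty.out

theorem eventually_differentiableAt_mul :
    ∀ᶠ p in 𝓝 ((0, 0) : E × E), DifferentiableAt ℝ (fun p : E × E => G.mul p.1 p.2) p :=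
  (G.contDiffAt_mul_two.eventually (by simp)).mono fun _ hp => hp.differentiableAt two_ne_zero

theorem contDiffAt_P_mul : ContDiffAt ℝ ∞ (fun g => P G.mul (0, g)) 0 :=
  ContDiffAt.comp (f := fun g : E => ((0, g) : E × E)) 0
    (contDiffAt_P G.contDiffAt_mul (by simp)) (by fun_prop)

theorem hasFDerivAt_P_mul :
    HasFDerivAt (fun g => P G.mul (0, g)) (mixedDeriv G.mul (0, 0)).flip 0 := by
  have hP := ((contDiffAt_P (m := 1) G.contDiffAt_mul_two one_add_one_eq_two.le).differentiableAt
    one_ne_zero).hasFDerivAt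
  refine (HasFDerivAt.comp (f := fun g : E => ((0, g) : E × E)) 0 hP
    (hasFDerivAt_prodMk_right 0 0)).congr_fderiv ?_
  ext w v
  simp [mixedDeriv_apply_eq_fderiv_P G.contDiffAt_mul_two]

theorem tendsto_smul_const_zero (x : E) : Tendsto (fun c : ℝ => c • x) (𝓝 0) (𝓝 0) := by
  simpa using ((hasDerivAt_id (0 : ℝ)).smul_const x).continuousAt.tendsto

theorem eventually_Q_mul_smul_apply_self :
    ∀ᶠ x in 𝓝 (0 : E), ∀ᶠ s in 𝓝 (0 : ℝ), Q G.mul (s • x, 0) x = x := by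
  filter_upwards [G.mul_smul_smul] with x hx
  filter_upwards [((tendsto_smul_const_zero x).prodMk_nhds tendsto_const_nhds).eventually
    G.eventually_differentiableAt_mul, Icc_mem_nhds neg_one_lt_zero one_pos] with s hμ hs
  have hQ : HasFDerivAt (G.mul (s • x)) (Q G.mul (s • x, 0)) ((0 : ℝ) • x) := by
    rw [zero_smul]
    exact (HasFDerivAt.comp (f := fun y => (s • x, y)) (0 : E) hμ.hasFDerivAt
      (hasFDerivAt_prodMk_right (s • x) 0)).differentiableAt.hasFDerivAt
  have hflow : (fun t : ℝ => G.mul (s • x) (t • x)) =ᶠ[𝓝 0] fun t => (s + t) • x :=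
    mem_of_superset (Icc_mem_nhds neg_one_lt_zero one_pos) fun t ht => hx s hs t ht
  have hline (c : ℝ) : HasDerivAt (fun t : ℝ => (c + t) • x) x 0 := by
    simpa using ((hasDerivAt_id (0 : ℝ)).const_add c).smul_const x
  have hmul := hQ.comp_hasDerivAt (0 : ℝ) (by simpa using hline 0)
  exact hmul.unique ((hline s).congr_of_eventuallyEq hflow)

theorem mixedDeriv_mul_self (X : E) : mixedDeriv G.mul (0, 0) X X = 0 := by
  have hQ : HasFDerivAt (fun x => Q G.mul (x, 0)) (mixedDeriv G.mul (0, 0)) 0 :=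
    DifferentiableAt.hasFDerivAt (.comp (f := fun x : E => (x, (0 : E))) 0
      ((contDiffAt_Q (m := 1) G.contDiffAt_mul_two one_add_one_eq_two.le).differentiableAt
        one_ne_zero) (by fun_prop))
  have small : ∀ᶠ x in 𝓝 (0 : E), mixedDeriv G.mul (0, 0) x x = 0 := by
    filter_upwards [G.eventually_Q_mul_smul_apply_self] with x hx
    have hline : HasDerivAt (fun s : ℝ => s • x) x 0 := by
      simpa using (hasDerivAt_id (0 : ℝ)).smul_const x
    have hQx : HasDerivAt (fun s : ℝ => Q G.mul (s • x, 0) x) (mixedDeriv G.mul (0, 0) x x) 0 := by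
      simpa using (HasFDerivAt.comp_hasDerivAt (l := fun x => Q G.mul (x, 0)) (0 : ℝ)
        (by simpa using hQ) hline).clm_apply (hasDerivAt_const (0 : ℝ) x)
    exact hQx.unique ((hasDerivAt_const (0 : ℝ) x).congr_of_eventuallyEq hx)
  obtain ⟨c, hc, hc0⟩ := (((tendsto_smul_const_zero X).eventually small).filter_mono
    nhdsWithin_le_nhds |>.and (self_mem_nhdsWithin (s := {0}ᶜ))).exists
  simpa [show c ≠ 0 from hc0] using hc

/-- The Lie bracket of a local Lie group as a continuous bilinear map. -/
noncomputable def bracketL : E →L[ℝ] E →L[ℝ] E :=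
  mixedDeriv G.mul (0, 0) - (mixedDeriv G.mul (0, 0)).flip

theorem bracketL_apply (X Y : E) : G.bracketL X Y = G.bracket X Y := rfl

theorem bracketL_skew (X Y : E) : G.bracketL X Y = -G.bracketL Y X := (neg_sub _ _).symm

/-- The right logarithmic derivative `ds · s⁻¹` of a map `s` into a local Lie group. -/
noncomputable def logDeriv {F : Type*} [NormedAddCommGroup F] [NormedSpace ℝ F] (s : F → E)
    (x : F) : F →L[ℝ] E :=
  (P G.mul (0, s x)).inverse ∘L fderiv ℝ s x

section LogDeriv

variable {F : Type*} [NormedAddCommGroup F] [NormedSpace ℝ F] {s : F → E}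

theorem logDeriv_zero (h0 : s 0 = 0) : G.logDeriv s 0 = fderiv ℝ s 0 := by
  simp [logDeriv, h0, P_mul_zero]

variable [CompleteSpace E]

theorem eventually_isInvertible_P_mul : ∀ᶠ g in 𝓝 (0 : E), (P G.mul (0, g)).IsInvertible :=
  G.contDiffAt_P_mul.continuousAt.eventually (eventually_isInvertible
    (by simpa only [G.P_mul_zero] using ⟨.refl ℝ E, rfl⟩))

theorem contDiffAt_logDeriv (hs : ContDiffAt ℝ ∞ s 0) (h0 : s 0 = 0) :
    ContDiffAt ℝ ∞ (G.logDeriv s) 0 := by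
  have hP : ContDiffAt ℝ ∞ (fun x => P G.mul (0, s x)) 0 :=
    ContDiffAt.comp (g := fun g => P G.mul (0, g)) 0 (by simpa [h0] using G.contDiffAt_P_mul) hs
  have hinv : (P G.mul (0, s 0)).IsInvertible := by
    rw [h0]
    exact G.eventually_isInvertible_P_mul.self_of_nhds
  exact (ContDiffAt.comp (f := fun x => P G.mul (0, s x)) 0 hinv.contDiffAt_map_inverse hP).clm_comp
    (hs.fderiv_right (by simp))

theorem fderiv_logDeriv_zero_self (hs : ContDiffAt ℝ ∞ s 0) (h0 : s 0 = 0) (v : F) :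
    fderiv ℝ (G.logDeriv s) 0 v v = fderiv ℝ (fderiv ℝ s) 0 v v := by
  have hθ := ((G.contDiffAt_logDeriv hs h0).differentiableAt (by simp)).hasFDerivAt
  have hs' := (hs.differentiableAt (by simp)).hasFDerivAt
  have hP : HasFDerivAt (fun x => P G.mul (0, s x))
      ((mixedDeriv G.mul (0, 0)).flip ∘L fderiv ℝ s 0) 0 :=
    HasFDerivAt.comp (g := fun g => P G.mul (0, g)) 0
      (by simpa [h0] using G.hasFDerivAt_P_mul) hs'
  have htends : Tendsto s (𝓝 0) (𝓝 0) := by simpa [h0] using hs.continuousAt.tendsto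
  have hmul : fderiv ℝ s =ᶠ[𝓝 0] fun x => P G.mul (0, s x) ∘L G.logDeriv s x := by
    filter_upwards [htends.eventually G.eventually_isInvertible_P_mul] with x hx
    ext w
    exact (hx.self_apply_inverse _).symm
  rw [hmul.fderiv_eq, (hP.clm_comp hθ).fderiv]
  simp [h0, P_mul_zero, logDeriv_zero, mixedDeriv_mul_self]

end LogDeriv

end LocalLieGroup

section LocalAction

open ThreeWeb

variable {E F : Type*} [NormedAddCommGroup E] [NormedSpace ℝ E] [NormedAddCommGroup F]
  [NormedSpace ℝ F]

/-- A smooth local left action `(g, z) ↦ a g z` of a local Lie group near `0`. -/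
structure IsLocalAction (G : LocalLieGroup E) (a : E → F → F) : Prop where
  contDiffAt : ContDiffAt ℝ ∞ (fun p : E × F => a p.1 p.2) (0, 0)
  zero_act : ∀ᶠ z in 𝓝 (0 : F), a 0 z = z
  act_act : ∀ᶠ p in 𝓝 ((0, 0, 0) : E × E × F),
    a p.1 (a p.2.1 p.2.2) = a (G.mul p.1 p.2.1) p.2.2

/-- The infinitesimal action of the Lie algebra: `infAct a z X` is the velocity at `z` of the
vector field generated by `X`. -/
noncomputable def infAct (a : E → F → F) (z : F) : E →L[ℝ] F := fderiv ℝ (fun g => a g z) 0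

namespace IsLocalAction

variable {G : LocalLieGroup E} {a : E → F → F} (h : IsLocalAction G a)
include h

theorem contDiffAt_infAct : ContDiffAt ℝ ∞ (infAct a) 0 :=
  ContDiffAt.fderiv (f := fun z g => a g z) (n := ∞)
    (h.contDiffAt.comp (0, 0) (contDiffAt_snd.prodMk contDiffAt_fst)) contDiffAt_const (by simp)

theorem eventually_differentiableAt :
    ∀ᶠ p in 𝓝 ((0, 0) : E × F), DifferentiableAt ℝ (fun p : E × F => a p.1 p.2) p :=
  ((h.contDiffAt.of_le (m := 1) ENat.LEInfty.out).eventually (by simp)).mono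
    fun _ hp => hp.differentiableAt one_ne_zero

theorem eventually_infAct_act : ∀ᶠ p in 𝓝 ((0, 0) : E × F),
    infAct a (a p.1 p.2) = fderiv ℝ (fun g => a g p.2) p.1 ∘L P G.mul (0, p.1) := by
  have hG : Tendsto (fun p : E × F => ((0 : E), p.1)) (𝓝 (0, 0)) (𝓝 (0, 0)) :=
    Continuous.tendsto' (by fun_prop) _ _ rfl
  have hact : ∀ᶠ p in 𝓝 ((0, 0) : E × F), ∀ᶠ g in 𝓝 (0 : E),
      a g (a p.1 p.2) = a (G.mul g p.1) p.2 :=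
    ((continuous_swap.tendsto ((0, 0), 0)).eventually h.act_act).curry_nhds
  filter_upwards [hG.eventually G.eventually_differentiableAt_mul,
    continuousAt_fst.eventually G.zero_mul, h.eventually_differentiableAt, hact]
    with p hmul hzero ha hact
  have hP : HasFDerivAt (fun g => G.mul g p.1) (P G.mul (0, p.1)) 0 :=
    (HasFDerivAt.comp (f := fun g : E => (g, p.1)) (0 : E) hmul.hasFDerivAt
      (hasFDerivAt_prodMk_left 0 p.1)).differentiableAt.hasFDerivAt
  have hap : HasFDerivAt (fun g => a g p.2) (fderiv ℝ (fun g => a g p.2) p.1)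
      (G.mul 0 p.1) := by
    rw [hzero]
    exact (HasFDerivAt.comp (f := fun g : E => (g, p.2)) p.1 ha.hasFDerivAt
      (hasFDerivAt_prodMk_left p.1 p.2)).differentiableAt.hasFDerivAt
  rw [infAct, EventuallyEq.fderiv_eq hact]
  exact (hap.comp 0 hP).fderiv

theorem eventually_fderiv_infAct_sub : ∀ᶠ z in 𝓝 (0 : F), ∀ X Y,
    fderiv ℝ (infAct a) z (infAct a z Y) X - fderiv ℝ (infAct a) z (infAct a z X) Y =
      infAct a z (G.bracketL X Y) := by
  have hz : Tendsto (fun z : F => ((0 : E), z)) (𝓝 0) (𝓝 (0, 0)) :=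
    (Continuous.prodMk_right (0 : E)).tendsto 0
  filter_upwards [hz.eventually (eventually_eventually_nhds.2 h.eventually_infAct_act),
    hz.eventually ((h.contDiffAt.of_le (m := 2) ENat.LEInfty.out).eventually (by simp)),
    (h.contDiffAt_infAct.of_le (m := 1) ENat.LEInfty.out).eventually (by simp),
    h.zero_act] with z heq ha hA hzero X Y
  set f : E → F := fun g => a g z
  have hf : ContDiffAt ℝ 2 f 0 := ContDiffAt.comp (f := fun g : E => (g, z)) 0 ha (by fun_prop)
  have hf' : HasFDerivAt (fderiv ℝ f) (fderiv ℝ (fderiv ℝ f) 0) 0 :=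
    ((hf.fderiv_right (m := 1) one_add_one_eq_two.le).differentiableAt one_ne_zero).hasFDerivAt
  have hA' : HasFDerivAt (infAct a) (fderiv ℝ (infAct a) z) (f 0) := by
    rw [show f 0 = z from hzero]
    exact (hA.differentiableAt one_ne_zero).hasFDerivAt
  have heq' : (fun g => infAct a (f g)) =ᶠ[𝓝 0] fun g => fderiv ℝ f g ∘L P G.mul (0, g) :=
    (Continuous.prodMk_left z).tendsto' (0 : E) (0, z) rfl |>.eventually heq
  have key := (hA'.comp 0 (hf.differentiableAt two_ne_zero).hasFDerivAt).unique
    ((hf'.clm_comp G.hasFDerivAt_P_mul).congr_of_eventuallyEq heq')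
  have equivariance (X Y : E) : fderiv ℝ (infAct a) z (infAct a z Y) X =
      fderiv ℝ (fderiv ℝ f) 0 Y X + infAct a z (mixedDeriv G.mul (0, 0) X Y) := by
    simpa [show infAct a z = fderiv ℝ f 0 from rfl, G.P_mul_zero, add_comm] using congr($key Y X)
  -- The second derivatives of the action are symmetric, so antisymmetrization removes them.
  rw [equivariance, equivariance, (hf.isSymmSndFDerivAt (by simp)).eq X Y]
  simp [LocalLieGroup.bracketL]

end IsLocalAction

end LocalAction

/-! ### Loops given by a section of an action -/

section SectionLoop

open ThreeWeb

theorem fderiv_comp_prodMk_of_forall_eq_zero {𝕜 Z V W : Type*} [NontriviallyNormedField 𝕜]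
    [NormedAddCommGroup Z] [NormedSpace 𝕜 Z] [NormedAddCommGroup V] [NormedSpace 𝕜 V]
    [NormedAddCommGroup W] [NormedSpace 𝕜 W] {g : Z → V → W} {u : Z → V} {z₀ : Z} {v₀ : V}
    (hg : DifferentiableAt 𝕜 (fun p : Z × V => g p.1 p.2) (z₀, v₀))
    (hu : DifferentiableAt 𝕜 u z₀) (hu₀ : u z₀ = v₀) (h : ∀ v, g z₀ v = 0) :
    fderiv 𝕜 (fun z => g z (u z)) z₀ = fderiv 𝕜 (fun z => g z v₀) z₀ := by
  subst hu₀
  have hD := hg.hasFDerivAt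
  have graph := HasFDerivAt.comp (f := fun z => (z, u z)) z₀ hD
    ((hasFDerivAt_id z₀).prodMk hu.hasFDerivAt)
  have horizontal := HasFDerivAt.comp (f := fun z => (z, u z₀)) z₀ hD
    (hasFDerivAt_prodMk_left z₀ (u z₀))
  have vertical := (HasFDerivAt.comp (f := fun v => (z₀, v)) (u z₀) hD
    (hasFDerivAt_prodMk_right z₀ (u z₀))).unique
      ((hasFDerivAt_const (0 : W) (u z₀)).congr_of_eventuallyEq (.of_forall h))
  refine graph.fderiv.trans (Eq.trans ?_ horizontal.fderiv.symm)
  ext w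
  have hw := congr($vertical (fderiv 𝕜 u z₀ w))
  simp only [ContinuousLinearMap.comp_apply, ContinuousLinearMap.inr_apply, zero_apply] at hw
  have split := map_add (fderiv 𝕜 (fun p : Z × V => g p.1 p.2) (z₀, u z₀)) (w, 0)
    (0, fderiv 𝕜 u z₀ w)
  simpa [hw] using split

variable {E F : Type*} [NormedAddCommGroup E] [NormedSpace ℝ E] [NormedAddCommGroup F]
  [NormedSpace ℝ F]

/-- The loop product on `F` for which `x × z` is the image of `z` under the group element `s x`. -/
def sectionLoop (a : E → F → F) (s : F → E) (x z : F) : F := a (s x) z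

/-- A smooth map `s` through the identity, inverse to the orbit map `g ↦ a g 0` to first order, and
with second derivatives in the Lie algebra of the stabilizer of `0`.  In normal coordinates these
are the properties of the section `ξ ↦ ξ + φ ξ` on which the web depends. -/
structure IsAdaptedSection (a : E → F → F) (s : F → E) : Prop where
  contDiffAt : ContDiffAt ℝ ∞ s 0
  apply_zero : s 0 = 0
  infAct_fderiv : ∀ v, infAct a 0 (fderiv ℝ s 0 v) = v
  infAct_fderiv_fderiv : ∀ v w, infAct a 0 (fderiv ℝ (fderiv ℝ s) 0 v w) = 0

namespace IsAdaptedSection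

variable {G : LocalLieGroup E} {a : E → F → F} {s : F → E} (hs : IsAdaptedSection a s)
  (h : IsLocalAction G a)
include hs h

theorem contDiffAt_sectionLoop :
    ContDiffAt ℝ ∞ (fun p : F × F => sectionLoop a s p.1 p.2) (0, 0) := by
  refine ContDiffAt.comp (g := fun p : E × F => a p.1 p.2) (f := fun p : F × F => (s p.1, p.2))
    (0, 0) (by simpa [hs.apply_zero] using h.contDiffAt) (.prodMk ?_ contDiffAt_snd)
  exact ContDiffAt.comp (g := s) (f := Prod.fst) (0, 0) hs.contDiffAt contDiffAt_fst

theorem sectionLoop_zero_left : ∀ᶠ z in 𝓝 (0 : F), sectionLoop a s 0 z = z := by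
  simpa only [sectionLoop, hs.apply_zero] using h.zero_act

theorem Q_sectionLoop_zero_left :
    ∀ᶠ z in 𝓝 (0 : F), Q (sectionLoop a s) (0, z) = ContinuousLinearMap.id ℝ F := by
  filter_upwards [(hs.sectionLoop_zero_left h).eventually_nhds] with z hz
  exact ((hasFDerivAt_id z).congr_of_eventuallyEq hz).fderiv

variable [CompleteSpace E]

theorem P_sectionLoop : ∀ᶠ p in 𝓝 ((0, 0) : F × F), P (sectionLoop a s) p =
    infAct a (sectionLoop a s p.1 p.2) ∘L G.logDeriv s p.1 := by
  have hs₁ : Tendsto (fun p : F × F => s p.1) (𝓝 (0, 0)) (𝓝 0) := by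
    have := hs.contDiffAt.continuousAt.tendsto.comp (tendsto_fst (f := 𝓝 (0 : F)) (g := 𝓝 (0 : F)))
    rwa [hs.apply_zero, ← nhds_prod_eq] at this
  have hs₂ : Tendsto (fun p : F × F => (s p.1, p.2)) (𝓝 (0, 0)) (𝓝 (0, 0)) :=
    hs₁.prodMk_nhds continuousAt_snd
  filter_upwards [hs₂.eventually h.eventually_infAct_act,
    hs₂.eventually h.eventually_differentiableAt,
    hs₁.eventually G.eventually_isInvertible_P_mul, continuousAt_fst.eventually
      ((hs.contDiffAt.of_le (m := 1) ENat.LEInfty.out).eventually (by simp))] with p hA ha hP hs'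
  have ha' : HasFDerivAt (fun g => a g p.2) (fderiv ℝ (fun g => a g p.2) (s p.1)) (s p.1) :=
    (HasFDerivAt.comp (f := fun g : E => (g, p.2)) (s p.1) ha.hasFDerivAt
      (hasFDerivAt_prodMk_left (s p.1) p.2)).differentiableAt.hasFDerivAt
  have hP' : P (sectionLoop a s) p = _ :=
    (ha'.comp p.1 (hs'.differentiableAt one_ne_zero).hasFDerivAt).fderiv
  rw [hP', sectionLoop, hA]
  ext v
  simp [LocalLieGroup.logDeriv, hP.self_apply_inverse]

theorem P_sectionLoop_zero_left : ∀ᶠ z in 𝓝 (0 : F),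
    P (sectionLoop a s) (0, z) = infAct a z ∘L fderiv ℝ s 0 := by
  have hz : Tendsto (fun z : F => ((0 : F), z)) (𝓝 0) (𝓝 (0, 0)) :=
    (Continuous.prodMk_right (0 : F)).tendsto 0
  filter_upwards [hz.eventually (hs.P_sectionLoop h), hs.sectionLoop_zero_left h] with z hP hμ
  rw [hP, hμ, G.logDeriv_zero hs.apply_zero]

omit h [CompleteSpace E] in
theorem infAct_comp_fderiv : infAct a 0 ∘L fderiv ℝ s 0 = ContinuousLinearMap.id ℝ F :=
  ContinuousLinearMap.ext hs.infAct_fderiv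

omit h [CompleteSpace E] in
theorem isInvertible_infAct_comp_fderiv : (infAct a 0 ∘L fderiv ℝ s 0).IsInvertible := by
  rw [hs.infAct_comp_fderiv]
  exact ⟨.refl ℝ F, rfl⟩

theorem regularAt {n : WithTop ℕ∞} (hn : n ≤ ∞) : RegularAt n (sectionLoop a s) (0, 0) where
  contDiffAt := (hs.contDiffAt_sectionLoop h).of_le hn
  isInvertible_P := by
    rw [(hs.P_sectionLoop_zero_left h).self_of_nhds]
    exact hs.isInvertible_infAct_comp_fderiv
  isInvertible_Q := by
    rw [(hs.Q_sectionLoop_zero_left h).self_of_nhds]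
    exact ⟨.refl ℝ F, rfl⟩

theorem solvesLieEquationAt :
    SolvesLieEquationAt (sectionLoop a s) (infAct a) (G.logDeriv s) (0, 0) where
  regularAt := hs.regularAt h ENat.LEInfty.out
  contDiffAt_A := by
    rw [(hs.sectionLoop_zero_left h).self_of_nhds]
    exact h.contDiffAt_infAct.of_le ENat.LEInfty.out
  contDiffAt_θ := (G.contDiffAt_logDeriv hs.contDiffAt hs.apply_zero).of_le ENat.LEInfty.out
  P_eq := hs.P_sectionLoop h

end IsAdaptedSection

end SectionLoop

section LeafCurvature

open ThreeWeb

variable {E F : Type*} [NormedAddCommGroup E] [NormedSpace ℝ E] [NormedAddCommGroup F]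
  [NormedSpace ℝ F]

/-- For the section loop of `s`, the value of the curvature form `b (0, z) ξ ξ ξ` on the leaf
`x = 0`, as a function of the vector `v` with `P (0, z) v = ξ`. -/
noncomputable def leafCurvature (G : LocalLieGroup E) (a : E → F → F) (s : F → E) (z v : F) : F :=
  -infAct a z (G.bracketL
    (kerProj (infAct a z) (fderiv ℝ s 0) (fderiv ℝ (fderiv ℝ s) 0 v v)) (fderiv ℝ s 0 v))

namespace IsAdaptedSection

variable {G : LocalLieGroup E} {a : E → F → F} {s : F → E} (hs : IsAdaptedSection a s)
  (h : IsLocalAction G a)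
include hs

theorem leafCurvature_zero (v : F) : leafCurvature G a s 0 v =
    -infAct a 0 (G.bracketL (fderiv ℝ (fderiv ℝ s) 0 v v) (fderiv ℝ s 0 v)) := by
  simp only [leafCurvature, kerProj_apply, hs.infAct_fderiv_fderiv, map_zero, sub_zero]

include h

variable [CompleteSpace F]

theorem fderiv_leafCurvature_zero {v : F}
    (hv : infAct a 0 (G.bracketL (fderiv ℝ (fderiv ℝ s) 0 v v) (fderiv ℝ s 0 v)) = 0) (τ : F) :
    fderiv ℝ (fun z => leafCurvature G a s z v) 0 τ =
      infAct a 0 (G.bracketL (fderiv ℝ s 0 τ)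
          (G.bracketL (fderiv ℝ (fderiv ℝ s) 0 v v) (fderiv ℝ s 0 v))
        - G.bracketL (fderiv ℝ s 0 (infAct a 0
          (G.bracketL (fderiv ℝ s 0 τ) (fderiv ℝ (fderiv ℝ s) 0 v v)))) (fderiv ℝ s 0 v)) := by
  have hA : HasFDerivAt (infAct a) (fderiv ℝ (infAct a) 0) 0 :=
    (h.contDiffAt_infAct.differentiableAt (by simp)).hasFDerivAt
  have hK := hasFDerivAt_kerProj_apply hA hs.isInvertible_infAct_comp_fderiv
    (hs.infAct_fderiv_fderiv v v)
  have hleaf := (hA.clm_apply ((G.bracketL.flip (fderiv ℝ s 0 v)).hasFDerivAt.comp 0 hK)).neg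
  have hA' {K : E} (hK : infAct a 0 K = 0) :
      fderiv ℝ (infAct a) 0 τ K = infAct a 0 (G.bracketL K (fderiv ℝ s 0 τ)) := by
    simpa [hs.infAct_fderiv, hK] using
      h.eventually_fderiv_infAct_sub.self_of_nhds K (fderiv ℝ s 0 τ)
  refine congr($(hleaf.fderiv) τ).trans ?_
  rw [G.bracketL_skew (fderiv ℝ s 0 τ), G.bracketL_skew (fderiv ℝ s 0 τ)]
  simp [kerProj_apply, hs.infAct_fderiv_fderiv, hs.infAct_comp_fderiv, hA' hv,
    hA' (hs.infAct_fderiv_fderiv v v)]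

theorem differentiableAt_inverse_infAct_comp_fderiv :
    DifferentiableAt ℝ (fun z => (infAct a z ∘L fderiv ℝ s 0).inverse) 0 := by
  have hA := h.contDiffAt_infAct.differentiableAt (by simp)
  exact .comp (f := fun z => infAct a z ∘L fderiv ℝ s 0) 0
    (hs.isInvertible_infAct_comp_fderiv.contDiffAt_map_inverse.differentiableAt one_ne_zero)
    (by fun_prop)

theorem differentiableAt_leafCurvature (v : F) :
    DifferentiableAt ℝ (fun p : F × F => leafCurvature G a s p.1 p.2) (0, v) := by
  have hA : DifferentiableAt ℝ (fun p : F × F => infAct a p.1) (0, v) :=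
    .comp (g := infAct a) (f := Prod.fst) (0, v)
      (h.contDiffAt_infAct.differentiableAt (by simp)) differentiableAt_fst
  have hinv : DifferentiableAt ℝ (fun p : F × F => (infAct a p.1 ∘L fderiv ℝ s 0).inverse)
      (0, v) :=
    .comp (g := fun z => (infAct a z ∘L fderiv ℝ s 0).inverse) (f := Prod.fst) (0, v)
      (hs.differentiableAt_inverse_infAct_comp_fderiv h) differentiableAt_fst
  unfold leafCurvature
  simp only [kerProj_apply]
  fun_prop

variable [CompleteSpace E]

theorem b_diag_zero_left : ∀ᶠ z in 𝓝 (0 : F), ∀ ξ, b (sectionLoop a s) (0, z) ξ ξ ξ =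
    leafCurvature G a s z ((infAct a z ∘L fderiv ℝ s 0).inverse ξ) := by
  have hz : Tendsto (fun z : F => ((0 : F), z)) (𝓝 0) (𝓝 (0, 0)) :=
    (Continuous.prodMk_right (0 : F)).tendsto 0
  filter_upwards [hz.eventually (hs.solvesLieEquationAt h).eventually,
    hs.sectionLoop_zero_left h, hs.P_sectionLoop_zero_left h, h.eventually_fderiv_infAct_sub]
    with z hLie hμ hP hbracket ξ
  have hinv := hLie.regularAt.isInvertible_P
  rw [hLie.b_diag, leafCurvature]
  simp only [hμ, G.logDeriv_zero hs.apply_zero,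
    G.fderiv_logDeriv_zero_self hs.contDiffAt hs.apply_zero, hP] at hinv ⊢
  set v := (infAct a z ∘L fderiv ℝ s 0).inverse ξ
  have hv : infAct a z (fderiv ℝ s 0 v) = ξ := hinv.self_apply_inverse ξ
  rw [← hbracket, hv, apply_kerProj hinv, map_zero, zero_apply, sub_zero]

theorem symBVanishesAt_iff : SymBVanishesAt (sectionLoop a s) (0, 0) ↔
    ∀ v, infAct a 0 (G.bracketL (fderiv ℝ (fderiv ℝ s) 0 v v) (fderiv ℝ s 0 v)) = 0 := by
  rw [(hs.regularAt h ENat.LEInfty.out).symBVanishesAt_iff]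
  refine forall_congr' fun v => ?_
  rw [(hs.b_diag_zero_left h).self_of_nhds, hs.infAct_comp_fderiv,
    ContinuousLinearMap.inverse_id, ContinuousLinearMap.id_apply, hs.leafCurvature_zero,
    neg_eq_zero]

theorem d_diag (hB : SymBVanishesAt (sectionLoop a s) (0, 0)) (v τ : F) :
    d (sectionLoop a s) (0, 0) v v v τ =
      infAct a 0 (G.bracketL (fderiv ℝ s 0 τ)
          (G.bracketL (fderiv ℝ (fderiv ℝ s) 0 v v) (fderiv ℝ s 0 v))
        - G.bracketL (fderiv ℝ s 0 (infAct a 0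
          (G.bracketL (fderiv ℝ s 0 τ) (fderiv ℝ (fderiv ℝ s) 0 v v)))) (fderiv ℝ s 0 v)) := by
  have hreg : RegularAt 4 (sectionLoop a s) (0, 0) := hs.regularAt h ENat.LEInfty.out
  have hd : d (sectionLoop a s) (0, 0) v v v τ =
      fderiv ℝ (fun q => b (sectionLoop a s) q v v v) (0, 0) (0, τ) := by
    simpa [sym₃_diag, frame₂, (hs.Q_sectionLoop_zero_left h).self_of_nhds] using
      hB.sym₃_d hreg v v v τ
  have hleaf := HasFDerivAt.comp (f := fun z : F => ((0 : F), z)) 0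
    (hreg.differentiableAt_b v v v).hasFDerivAt (hasFDerivAt_prodMk_right 0 0)
  have hbracket := (hs.symBVanishesAt_iff h).1 hB
  have hvanish (w : F) : leafCurvature G a s 0 w = 0 := by
    rw [hs.leafCurvature_zero, hbracket, neg_zero]
  have hu : DifferentiableAt ℝ (fun z => (infAct a z ∘L fderiv ℝ s 0).inverse v) 0 :=
    (hs.differentiableAt_inverse_infAct_comp_fderiv h).clm_apply (differentiableAt_const v)
  have hb : (fun z => b (sectionLoop a s) (0, z) v v v) =ᶠ[𝓝 0] fun z =>
      leafCurvature G a s z ((infAct a z ∘L fderiv ℝ s 0).inverse v) :=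
    (hs.b_diag_zero_left h).mono fun z hz => hz v
  rw [hd, ← hs.fderiv_leafCurvature_zero h (hbracket v), ← fderiv_comp_prodMk_of_forall_eq_zero
    (hs.differentiableAt_leafCurvature h v) hu (by simp [hs.infAct_comp_fderiv]) hvanish,
    ← hb.fderiv_eq]
  exact congr($(hleaf.fderiv) τ).symm

end IsAdaptedSection

end LeafCurvature

/-! ### Loops embedded in a local Lie group -/

theorem LocalLieGroup.tendsto_mul_zero {E X : Type*} [NormedAddCommGroup E] [NormedSpace ℝ E]
    (G : LocalLieGroup E) {l : Filter X} {f g : X → E} (hf : Tendsto f l (𝓝 0))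
    (hg : Tendsto g l (𝓝 0)) : Tendsto (fun x => G.mul (f x) (g x)) l (𝓝 0) := by
  have := G.contDiffAt_mul.continuousAt.tendsto.comp (hf.prodMk_nhds hg)
  rwa [G.mul_zero.self_of_nhds] at this

namespace EmbeddedLoop

variable {E : Type*} [NormedAddCommGroup E] [NormedSpace ℝ E] (L : EmbeddedLoop E)

theorem tendsto_sec : Tendsto L.sec (𝓝 0) (𝓝 0) := by
  simpa [L.sec_zero] using L.contDiffAt_sec.continuousAt.tendsto

theorem fderiv_fderiv_sec_zero (v w : L.V) :
    fderiv ℝ (fderiv ℝ L.sec) 0 v w = (2 : ℝ) • (L.R v w : E) := by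
  have hφ : ContDiffAt ℝ 2 L.φ 0 := L.contDiffAt_φ.of_le ENat.LEInfty.out
  have hsec : fderiv ℝ L.sec =ᶠ[𝓝 0] fun z =>
      L.V.subtypeL + L.𝔥.subtypeL.postcomp L.V (fderiv ℝ L.φ z) := by
    filter_upwards [hφ.eventually (by simp)] with z hz
    exact (L.V.subtypeL.hasFDerivAt.add (L.𝔥.subtypeL.hasFDerivAt.comp z
      (hz.differentiableAt two_ne_zero).hasFDerivAt)).fderiv
  have hφ' := ((hφ.fderiv_right (m := 1) one_add_one_eq_two.le).differentiableAt
    one_ne_zero).hasFDerivAt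
  have hsum := ((L.𝔥.subtypeL.postcomp L.V).hasFDerivAt.comp (0 : L.V) hφ').const_add L.V.subtypeL
  rw [(hsum.congr_of_eventuallyEq hsec).fderiv]
  simp [R]

theorem R_add_right (ξ η η' : L.V) : L.R ξ (η + η') = L.R ξ η + L.R ξ η' := by simp [R]

theorem R_symm (ξ η : L.V) : L.R ξ η = L.R η ξ := by
  have hφ : ContDiffAt ℝ 2 L.φ 0 := L.contDiffAt_φ.of_le ENat.LEInfty.out
  rw [R, (hφ.isSymmSndFDerivAt (by simp)).eq ξ η, R]

theorem secMul_zero : L.secMul 0 = 0 := by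
  simpa [secMul, L.sec_zero] using L.G.mul_zero.self_of_nhds

variable [FiniteDimensional ℝ E]

/-- The coordinates in `Q × H` of a point of `G`. -/
noncomputable def factor : E → L.V × L.𝔥 :=
  haveI : CompleteSpace (L.V × L.𝔥) := FiniteDimensional.complete ℝ (L.V × L.𝔥)
  L.contDiffAt_secMul.localInverse L.hasFDerivAt_secMul (by simp)

theorem projQ_eq (g : E) : L.projQ g = (L.factor g).1 := rfl

theorem contDiffAt_factor : ContDiffAt ℝ ∞ L.factor 0 := by
  have : CompleteSpace (L.V × L.𝔥) := FiniteDimensional.complete ℝ (L.V × L.𝔥)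
  have := L.contDiffAt_secMul.to_localInverse L.hasFDerivAt_secMul (by simp)
  rwa [L.secMul_zero] at this

theorem eventually_factor_secMul : ∀ᶠ p in 𝓝 (0 : L.V × L.𝔥), L.factor (L.secMul p) = p :=
  haveI : CompleteSpace (L.V × L.𝔥) := FiniteDimensional.complete ℝ (L.V × L.𝔥)
  (L.contDiffAt_secMul.hasStrictFDerivAt' L.hasFDerivAt_secMul (by simp)).eventually_left_inverse

theorem eventually_secMul_factor : ∀ᶠ g in 𝓝 (0 : E), L.secMul (L.factor g) = g := by
  have : CompleteSpace (L.V × L.𝔥) := FiniteDimensional.complete ℝ (L.V × L.𝔥)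
  have := (L.contDiffAt_secMul.hasStrictFDerivAt' L.hasFDerivAt_secMul
    (by simp)).eventually_right_inverse
  rwa [L.secMul_zero] at this

theorem tendsto_factor : Tendsto L.factor (𝓝 0) (𝓝 0) := by
  have h0 : L.factor 0 = 0 := by
    simpa [L.secMul_zero] using L.eventually_factor_secMul.self_of_nhds
  simpa [h0] using L.contDiffAt_factor.continuousAt.tendsto

theorem hasFDerivAt_factor :
    HasFDerivAt L.factor (L.decomp.symm : E →L[ℝ] L.V × L.𝔥) 0 := by
  have : CompleteSpace (L.V × L.𝔥) := FiniteDimensional.complete ℝ (L.V × L.𝔥)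
  have := (L.contDiffAt_secMul.hasStrictFDerivAt' L.hasFDerivAt_secMul (by simp)).to_localInverse
  rw [L.secMul_zero] at this
  exact this.hasFDerivAt

theorem decomp_symm_fst (X : E) : (L.decomp.symm X).1 = L.proj X := by
  obtain ⟨p, rfl⟩ := L.decomp.surjective X
  have : L.decomp p = (p.1 : E) + (p.2 : E) := Submodule.coe_prodEquivOfIsCompl' _ _ L.isCompl p
  rw [L.decomp.symm_apply_apply, this, proj, map_add, Submodule.projectionOnto_apply_left,
    Submodule.projectionOnto_apply_right, add_zero]

theorem eventually_projQ_mul_of_mem : ∀ᶠ p in 𝓝 ((0, 0) : L.V × E),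
    p.2 ∈ L.𝔥 → L.projQ (L.G.mul (L.sec p.1) p.2) = p.1 := by
  have hcoe : Topology.IsInducing (Prod.map id Subtype.val : L.V × L.𝔥 → L.V × E) :=
    Topology.IsInducing.id.prodMap .subtypeVal
  have hfactor := L.eventually_factor_secMul
  rw [hcoe.nhds_eq_comap, eventually_comap] at hfactor
  filter_upwards [hfactor] with p hp hmem
  exact congrArg Prod.fst (hp (p.1, ⟨p.2, hmem⟩) rfl)

theorem eventually_projQ_mul :
    ∀ᶠ p in 𝓝 ((0, 0) : E × L.𝔥), L.projQ (L.G.mul p.1 p.2) = L.projQ p.1 := by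
  have hfst : Tendsto (fun p : E × L.𝔥 => p.1) (𝓝 (0, 0)) (𝓝 0) := continuousAt_fst
  have hsnd : Tendsto (fun p : E × L.𝔥 => p.2) (𝓝 (0, 0)) (𝓝 0) := continuousAt_snd
  have hcoe : Tendsto (fun h : L.𝔥 => (h : E)) (𝓝 0) (𝓝 0) := continuous_subtype_val.tendsto 0
  have hQ : Tendsto (fun p : E × L.𝔥 => (L.factor p.1).1) (𝓝 (0, 0)) (𝓝 0) :=
    (L.tendsto_factor.comp hfst).fst_nhds
  have hH : Tendsto (fun p : E × L.𝔥 => (L.factor p.1).2) (𝓝 (0, 0)) (𝓝 0) :=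
    (L.tendsto_factor.comp hfst).snd_nhds
  have hHE := hcoe.comp hH
  have hE := hcoe.comp hsnd
  filter_upwards [hfst.eventually L.eventually_secMul_factor,
    (hH.prodMk_nhds hsnd).eventually L.mul_mem,
    ((L.tendsto_sec.comp hQ).prodMk_nhds (hHE.prodMk_nhds hE)).eventually L.G.mul_assoc,
    (hQ.prodMk_nhds (L.G.tendsto_mul_zero hHE hE)).eventually L.eventually_projQ_mul_of_mem]
    with ⟨g, h⟩ hg hmem hassoc hproj
  calc L.projQ (L.G.mul g h)
      = L.projQ (L.G.mul (L.G.mul (L.sec (L.factor g).1) (L.factor g).2) h) :=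
        congrArg (fun g => L.projQ (L.G.mul g h)) hg.symm
    _ = L.projQ (L.G.mul (L.sec (L.factor g).1) (L.G.mul (L.factor g).2 h)) :=
        congrArg L.projQ hassoc
    _ = L.projQ g := hproj hmem

/-- The action of `G` on `G / H`, in the coordinates of `Q`. -/
noncomputable def act (g : E) (z : L.V) : L.V := L.projQ (L.G.mul g (L.sec z))

theorem contDiffAt_act : ContDiffAt ℝ ∞ (fun p : E × L.V => L.act p.1 p.2) (0, 0) := by
  have hsec : ContDiffAt ℝ ∞ (fun p : E × L.V => L.sec p.2) (0, 0) :=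
    ContDiffAt.comp (g := L.sec) (f := Prod.snd) ((0, 0) : E × L.V) L.contDiffAt_sec contDiffAt_snd
  have hmul : ContDiffAt ℝ ∞ (fun p : E × L.V => L.G.mul p.1 (L.sec p.2)) (0, 0) :=
    ContDiffAt.comp (g := fun p : E × E => L.G.mul p.1 p.2)
      (f := fun p : E × L.V => (p.1, L.sec p.2)) (0, 0)
      (by simpa [L.sec_zero] using L.G.contDiffAt_mul) (contDiffAt_fst.prodMk hsec)
  refine contDiffAt_fst.comp ((0, 0) : E × L.V) (ContDiffAt.comp (g := L.factor)
    (f := fun p : E × L.V => L.G.mul p.1 (L.sec p.2)) (0, 0) ?_ hmul)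
  simpa [L.sec_zero, L.G.mul_zero.self_of_nhds] using L.contDiffAt_factor

theorem zero_act : ∀ᶠ z in 𝓝 (0 : L.V), L.act 0 z = z := by
  have haxis : Tendsto (fun z : L.V => (z, (0 : E))) (𝓝 0) (𝓝 (0, 0)) :=
    (Continuous.prodMk_left (0 : E)).tendsto 0
  filter_upwards [L.tendsto_sec.eventually L.G.zero_mul, L.tendsto_sec.eventually L.G.mul_zero,
    haxis.eventually L.eventually_projQ_mul_of_mem] with z hzero_mul hmul_zero hproj
  rw [act, hzero_mul, ← hmul_zero]
  exact hproj L.𝔥.zero_mem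

theorem act_act : ∀ᶠ p in 𝓝 ((0, 0, 0) : E × E × L.V),
    L.act p.1 (L.act p.2.1 p.2.2) = L.act (L.G.mul p.1 p.2.1) p.2.2 := by
  have hg : Tendsto (fun p : E × E × L.V => p.1) (𝓝 (0, 0, 0)) (𝓝 0) := continuousAt_fst
  have hg' : Tendsto (fun p : E × E × L.V => p.2.1) (𝓝 (0, 0, 0)) (𝓝 0) := continuousAt_snd.fst
  have hz : Tendsto (fun p : E × E × L.V => L.sec p.2.2) (𝓝 (0, 0, 0)) (𝓝 0) :=
    L.tendsto_sec.comp continuousAt_snd.snd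
  have hmul := L.G.tendsto_mul_zero hg' hz
  have hfactor := L.tendsto_factor.comp hmul
  have hsec := L.tendsto_sec.comp hfactor.fst_nhds
  have hcoe := (continuous_subtype_val.tendsto (0 : L.𝔥)).comp hfactor.snd_nhds
  filter_upwards [hmul.eventually L.eventually_secMul_factor,
    ((L.G.tendsto_mul_zero hg hsec).prodMk_nhds hfactor.snd_nhds).eventually L.eventually_projQ_mul,
    (hg.prodMk_nhds (hsec.prodMk_nhds hcoe)).eventually L.G.mul_assoc,
    (hg.prodMk_nhds (hg'.prodMk_nhds hz)).eventually L.G.mul_assoc]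
    with ⟨g, g', z⟩ hsecMul hproj hassoc hassoc'
  dsimp only [Function.comp_apply] at hsecMul hproj hassoc hassoc' ⊢
  set k := L.factor (L.G.mul g' (L.sec z))
  calc L.act g k.1 = L.projQ (L.G.mul (L.G.mul g (L.sec k.1)) k.2) := hproj.symm
    _ = L.projQ (L.G.mul g (L.secMul k)) := congrArg L.projQ hassoc
    _ = L.act (L.G.mul g g') z := by rw [hsecMul, ← hassoc', act]

theorem isLocalAction_act : IsLocalAction L.G L.act :=
  ⟨L.contDiffAt_act, L.zero_act, L.act_act⟩

theorem infAct_act_zero (X : E) : infAct L.act 0 X = L.proj X := by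
  have hact : (fun g => L.act g 0) =ᶠ[𝓝 0] fun g => (L.factor g).1 :=
    L.G.mul_zero.mono fun g hg => by simp only [act, L.sec_zero, hg, projQ_eq]
  rw [infAct, hact.fderiv_eq, L.hasFDerivAt_factor.fst.fderiv, ← L.decomp_symm_fst]
  rfl

theorem isAdaptedSection_sec : IsAdaptedSection L.act L.sec where
  contDiffAt := L.contDiffAt_sec
  apply_zero := L.sec_zero
  infAct_fderiv v := by
    rw [L.hasFDerivAt_sec.fderiv, L.infAct_act_zero]
    exact Submodule.projectionOnto_apply_left _ v
  infAct_fderiv_fderiv v w := by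
    rw [L.fderiv_fderiv_sec_zero, map_smul, L.infAct_act_zero, proj,
      Submodule.projectionOnto_apply_right, smul_zero]

theorem loopMul_eq_sectionLoop : L.loopMul = sectionLoop L.act L.sec := rfl

theorem regularAt_loopMul {n : WithTop ℕ∞} (hn : n ≤ ∞) :
    ThreeWeb.RegularAt n L.loopMul (0, 0) :=
  haveI : CompleteSpace L.V := FiniteDimensional.complete ℝ L.V
  L.isAdaptedSection_sec.regularAt L.isLocalAction_act hn

theorem symBVanishesAt_loopMul_iff : ThreeWeb.SymBVanishesAt L.loopMul (0, 0) ↔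
    ∀ ξ η ζ : L.V, L.proj (L.G.bracket (L.R ξ η) ζ) + L.proj (L.G.bracket (L.R η ζ) ξ) +
      L.proj (L.G.bracket (L.R ζ ξ) η) = 0 := by
  have : CompleteSpace E := FiniteDimensional.complete ℝ E
  have : CompleteSpace L.V := FiniteDimensional.complete ℝ L.V
  simp only [← L.G.bracketL_apply]
  rw [loopMul_eq_sectionLoop, L.isAdaptedSection_sec.symBVanishesAt_iff L.isLocalAction_act,
    ← forall_diag_eq_zero_iff_cyclic_sum_eq_zero
      (f := fun ξ η ζ : L.V => L.proj (L.G.bracketL (L.R ξ η) ζ))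
      (fun a b c => by rw [L.R_symm]) (fun a b b' c => by simp [L.R_add_right])
      (fun a b c c' => by simp)]
  simp [L.fderiv_fderiv_sec_zero, L.hasFDerivAt_sec.fderiv, L.infAct_act_zero]

theorem cyclic_sum_eq_zero_of_symDVanishesAt (hB : ThreeWeb.SymBVanishesAt L.loopMul (0, 0))
    (hD : ThreeWeb.SymDVanishesAt L.loopMul (0, 0)) (ξ η ζ τ : L.V) :
    L.proj (L.G.bracket τ (L.G.bracket (L.R ξ η) ζ)
        - L.G.bracket (L.proj (L.G.bracket τ (L.R ξ η))) ζ)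
      + L.proj (L.G.bracket τ (L.G.bracket (L.R η ζ) ξ)
        - L.G.bracket (L.proj (L.G.bracket τ (L.R η ζ))) ξ)
      + L.proj (L.G.bracket τ (L.G.bracket (L.R ζ ξ) η)
        - L.G.bracket (L.proj (L.G.bracket τ (L.R ζ ξ))) η) = 0 := by
  have : CompleteSpace E := FiniteDimensional.complete ℝ E
  have : CompleteSpace L.V := FiniteDimensional.complete ℝ L.V
  simp only [← L.G.bracketL_apply]
  refine (forall_diag_eq_zero_iff_cyclic_sum_eq_zero
    (f := fun ξ η ζ : L.V => L.proj (L.G.bracketL τ (L.G.bracketL (L.R ξ η) ζ)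
      - L.G.bracketL (L.proj (L.G.bracketL τ (L.R ξ η))) ζ))
    (fun a b c => by rw [L.R_symm]) (fun a b b' c => ?_) (fun a b c c' => ?_)).1 (fun v => ?_) ξ η ζ
  · simp only [L.R_add_right, Submodule.coe_add, map_add, add_apply, map_sub]
    abel
  · simp only [Submodule.coe_add, map_add, map_sub]
    abel
  have hd : ThreeWeb.d L.loopMul (0, 0) v v v τ = 0 := by
    simpa only [ThreeWeb.sym₃_diag] using hD v v v τ
  rw [loopMul_eq_sectionLoop, L.isAdaptedSection_sec.d_diag L.isLocalAction_act hB] at hd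
  simpa [L.fderiv_fderiv_sec_zero, L.hasFDerivAt_sec.fderiv, L.infAct_act_zero, ← smul_sub]
    using hd

end EmbeddedLoop

theorem mainTheorem11 {E : Type*} [NormedAddCommGroup E] [NormedSpace ℝ E] [FiniteDimensional ℝ E]
    (L : EmbeddedLoop E) :
    (ThreeWeb.SymBVanishesAt L.loopMul (0, 0) ↔
      ∀ ξ η ζ : L.V,
        L.proj (L.G.bracket (L.R ξ η) ζ) + L.proj (L.G.bracket (L.R η ζ) ξ)
          + L.proj (L.G.bracket (L.R ζ ξ) η) = 0) ∧
    (ThreeWeb.IsHexagonal L.loopMul →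
      ThreeWeb.SymBVanishesAt L.loopMul (0, 0) ∧ ThreeWeb.SymDVanishesAt L.loopMul (0, 0)) ∧
    (ThreeWeb.SymBVanishesAt L.loopMul (0, 0) → ThreeWeb.SymDVanishesAt L.loopMul (0, 0) →
      ∀ ξ η ζ τ : L.V,
        L.proj (L.G.bracket τ (L.G.bracket (L.R ξ η) ζ)
            - L.G.bracket (L.proj (L.G.bracket τ (L.R ξ η))) ζ)
          + L.proj (L.G.bracket τ (L.G.bracket (L.R η ζ) ξ)
            - L.G.bracket (L.proj (L.G.bracket τ (L.R η ζ))) ξ)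
          + L.proj (L.G.bracket τ (L.G.bracket (L.R ζ ξ) η)
            - L.G.bracket (L.proj (L.G.bracket τ (L.R ζ ξ))) η) = 0) := by
  refine ⟨L.symBVanishesAt_loopMul_iff, fun hexagonal => ?_, fun hB hD ξ η ζ τ => ?_⟩
  · have : CompleteSpace L.V := FiniteDimensional.complete ℝ L.V
    exact ⟨hexagonal.self_of_nhds,
      hexagonal.symDVanishesAt (L.regularAt_loopMul ENat.LEInfty.out)⟩
  · exact L.cyclic_sum_eq_zero_of_symDVanishesAt hB hD ξ η ζ τ
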